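/- Let $G$ be a connected, undirected, simple, anonymous graph with $n$ nodes, $m$ edges and maximum degree $\Delta$, in which the edges incident to each node $v$ carry distinct port numbers $1,\dots,\deg(v)$ (the two port numbers of an edge being unrelated). Let $k\le n$ robots with distinct identifiers $1,\dots,k$ be placed initially on arbitrary nodes of $G$, several robots being allowed on one node. Nodes have no memory; each robot has a memory, with the same content at every robot initially, and every robot knows $m,n,\Delta,k$. In each synchronous round every robot observes the degree of its node and the identifiers and memories of all robots at its node, computes, writes into the memories of robots at its node, and either stays or leaves through a port of its choice; a robot that moves learns the port through which it left and the port through which it entered. Dispersion asks that the robots reach a configuration in which they are on pairwise distinct nodes, and remain there. Then there are a deterministic algorithm and an absolute constant $C$ such that, for every such graph, port numbering and initial placement, the algorithm solves Dispersion in at most $C\cdot\min(m,k\Delta)\cdot\log_2 k$ rounds and uses at most $C\log_2 n$ bits at each robot. -/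

import Mathlib

/-!
Synchronous mobile robots on anonymous port-labelled graphs.

There are `k` robots; robot `i : Fin k` is the one with identifier `i + 1`. Nodes have neither
names visible to the robots nor memory. In every round all robots execute one
Communicate-Compute-Move cycle simultaneously.
-/

/-- A port labelling of a graph: at each node `v` the incident edges (equivalently, the
neighbours of `v`) are numbered bijectively by `deg v` labels. The labels `1, …, deg v` are
represented by the elements `0, …, deg v - 1` of `Fin (deg v)`. No relation between the two port
numbers of an edge is assumed. -/
structure PortLabelling {V : Type*} [Fintype V] (G : SimpleGraph V) [DecidableRel G.Adj] where
  port : ∀ v : V, Fin (G.degree v) ≃ G.neighborSet v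

namespace PortLabelling

variable {V : Type*} [Fintype V] {G : SimpleGraph V} [DecidableRel G.Adj]

/-- The node reached from `v` by leaving through port `p`. -/
def target (L : PortLabelling G) (v : V) (p : Fin (G.degree v)) : V := (L.port v p).1

/-- The port, at the node reached, through which one enters when leaving `v` through `p`. -/
def entry (L : PortLabelling G) (v : V) (p : Fin (G.degree v)) :
    Fin (G.degree (L.target v p)) :=
  (L.port (L.target v p)).symm ⟨v, SimpleGraph.Adj.symm (G := G) (L.port v p).2⟩

end PortLabelling

/-- What a robot with `b` bits of writable memory carries: those bits and, if it moved in the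
previous round, the pair (port it left through, port it entered through). -/
structure RobotState (b : ℕ) where
  mem : Fin b → Bool
  lastMove : Option (ℕ × ℕ)

/-- What can be observed at a node about the robots: for each robot, its state if it is at that
node, and nothing otherwise. -/
abbrev View (k b : ℕ) : Type := Fin k → Option (RobotState b)

/-- The outcome of a robot's computation at a node of degree `δ`: the information to be written
(if any) into the memory of each robot at that node, and the port (if any) used to leave. -/
structure RobotAction (k b δ : ℕ) where
  write : Fin k → Option (Fin b → Bool)
  exit : Option (Fin δ)

/-- A deterministic program for `k` robots: the number of bits of writable memory, their common
initial content, and an arbitrary function that determines the action of a robot from its own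
identifier, the degree of the node where it is, and its view of the robots at that node. -/
structure RobotProgram (k : ℕ) where
  memBits : ℕ
  initMem : Fin memBits → Bool
  compute : (self : Fin k) → (δ : ℕ) → View k memBits → RobotAction k memBits δ

/-- A configuration: the node and the state of every robot. -/
structure RobotConfig (V : Type*) (k b : ℕ) where
  pos : Fin k → V
  state : Fin k → RobotState b

namespace RobotProgram

variable {V : Type*} [Fintype V] [DecidableEq V] {G : SimpleGraph V} [DecidableRel G.Adj] {k : ℕ}

/-- The total number of bits kept at a robot in a graph of maximum degree `Δ`: its writable
memory, its identifier, and the two port numbers of its last move. -/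
def bits (P : RobotProgram k) (Δ : ℕ) : ℕ :=
  P.memBits + Nat.clog 2 k + 2 * Nat.clog 2 (Δ + 1)

/-- The robots start at arbitrary nodes, all with the same memory content. -/
def initial (P : RobotProgram k) (start : Fin k → V) : RobotConfig V k P.memBits where
  pos := start
  state := fun _ => ⟨P.initMem, none⟩

/-- The robots located at node `v`, as seen by the robots located at `v`. -/
def viewAt (P : RobotProgram k) (c : RobotConfig V k P.memBits) (v : V) : View k P.memBits :=
  fun j => if c.pos j = v then some (c.state j) else none

/-- The action computed by robot `i`. -/
def action (P : RobotProgram k) (G : SimpleGraph V) [DecidableRel G.Adj]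
    (c : RobotConfig V k P.memBits) (i : Fin k) :
    RobotAction k P.memBits (G.degree (c.pos i)) :=
  P.compute i (G.degree (c.pos i)) (P.viewAt c (c.pos i))

/-- The memory of robot `j` after the writes of this round: only robots at the node of `j`
(including `j`) can write into it; if several do, the one with the smallest identifier prevails;
if none does, the memory is unchanged. -/
def newMem (P : RobotProgram k) (G : SimpleGraph V) [DecidableRel G.Adj]
    (c : RobotConfig V k P.memBits) (j : Fin k) : Fin P.memBits → Bool :=
  ((List.finRange k).findSome? fun i =>
    if c.pos i = c.pos j then (P.action G c i).write j else none).getD (c.state j).mem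

/-- The node of robot `i` after this round. -/
def newPos (P : RobotProgram k) (L : PortLabelling G)
    (c : RobotConfig V k P.memBits) (i : Fin k) : V :=
  match (P.action G c i).exit with
  | none => c.pos i
  | some p => L.target (c.pos i) p

/-- The ports used by robot `i` in this round. -/
def newMove (P : RobotProgram k) (L : PortLabelling G)
    (c : RobotConfig V k P.memBits) (i : Fin k) : Option (ℕ × ℕ) :=
  match (P.action G c i).exit with
  | none => none
  | some p => some ((p : ℕ), (L.entry (c.pos i) p : ℕ))

/-- One synchronous round. -/
def round (P : RobotProgram k) (L : PortLabelling G) (c : RobotConfig V k P.memBits) :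
    RobotConfig V k P.memBits where
  pos := P.newPos L c
  state := fun i => ⟨P.newMem G c i, P.newMove L c i⟩

/-- The configuration after `t` rounds. -/
def run (P : RobotProgram k) (L : PortLabelling G) (start : Fin k → V) (t : ℕ) :
    RobotConfig V k P.memBits :=
  (P.round L)^[t] (P.initial start)

/-- Dispersion is solved within `T` rounds: after `T` rounds the robots are on pairwise distinct
nodes, and from then on no robot moves. -/
def SolvesDispersionWithin (P : RobotProgram k) (L : PortLabelling G) (start : Fin k → V)
    (T : ℕ) : Prop :=
  Function.Injective (P.run L start T).pos ∧
    ∀ t, T ≤ t → (P.run L start t).pos = (P.run L start T).pos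

end RobotProgram

/-- A deterministic algorithm. The robots know the number `n` of nodes, the number `m` of edges,
the maximum degree `Δ` and the number `k` of robots, so the program may depend on these four
numbers, and on nothing else. -/
abbrev DispersionAlgorithm : Type := (n m Δ k : ℕ) → RobotProgram k

/-!
The algorithm works in `⌊log₂ k⌋ + 1` phases of `O(min m (k * Δ))` rounds each. All robots share a
clock, so that a phase may depend on nothing but the positions of the robots at its start. A phase
consists of two depth-first searches and a walk.

At the start of a search, one robot settles at each node that holds robots; the others at the node
form a group, which explores the graph as one agent. Settled robots serve as memory of their nodes:
they store the group that owns the node, the port towards the parent in the search tree of that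
group, and the number of explored ports. If groups compete for a node, the one with the larger label
owns it and the other one waits. In the first search (`search true`) a group leaves one robot at
each empty node that it reaches; in the second one (`search false`) it turns back there, and
afterwards (`walk`) all robots that are not settled follow the stored ports up to a root.

The group with the largest label in its component of the graph of occupied nodes is never
disturbed, since a group never leaves its component (`Conf.tied_search`). Its search obeys the usual
invariant of depth-first search (`Conf.SearchInv`), with a measure of progress that grows by one in
each round (`Conf.Searching.step`) and is bounded by a multiple of the sum of the degrees of the
owned nodes, hence of `min m (k * Δ)`. Therefore it terminates in time:

* In the first search this group settles completely, for otherwise it would have explored the whole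
  graph with robots left over, and there would be more robots than nodes. So a component that still has a
  node with two robots contains two nodes that had several robots before
  (`Conf.multi_disperse`).
* In the second search this group comes to own the whole component, and the walk leads all robots
  of the component that are not settled to its root. So each component has at most one node
  with several robots (`Conf.multi_gather`).

Hence each phase halves the number of nodes that hold several robots
(`Conf.two_mul_card_multiNodes_phase`), and after `⌊log₂ k⌋ + 1` phases there are none.

The rules are stated in a model with a clock and structured memories (`ClockedRule`), and
`ClockedRule.toProgram` carries them over to robots with a memory of bits.
-/

set_option linter.unusedSectionVars false

/-! ### Ports as natural numbers -/

namespace PortLabelling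

variable {V : Type*} [Fintype V] {G : SimpleGraph V} [DecidableRel G.Adj]

/-- The node reached from `v` through port `p`; a number that is not a port leads back to `v`. -/
def tgt (L : PortLabelling G) (v : V) (p : ℕ) : V :=
  if h : p < G.degree v then L.target v ⟨p, h⟩ else v

/-- The port through which one enters when leaving `v` through port `p`; it is `0` if `p` is not
a port of `v`. -/
def ent (L : PortLabelling G) (v : V) (p : ℕ) : ℕ :=
  if h : p < G.degree v then (L.entry v ⟨p, h⟩ : ℕ) else 0

theorem adj_tgt (L : PortLabelling G) {v : V} {p : ℕ} (h : p < G.degree v) :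
    G.Adj v (L.tgt v p) := by
  simp only [tgt, h, dif_pos]
  exact (L.port v ⟨p, h⟩).2

theorem ent_lt (L : PortLabelling G) {v : V} {p : ℕ} (h : p < G.degree v) :
    L.ent v p < G.degree (L.tgt v p) := by
  rw [tgt, ent, dif_pos h, dif_pos h]
  exact (L.entry v ⟨p, h⟩).2

theorem tgt_ent (L : PortLabelling G) {v : V} {p : ℕ} (h : p < G.degree v) :
    L.tgt (L.tgt v p) (L.ent v p) = v := by
  have e1 : L.tgt v p = L.target v ⟨p, h⟩ := dif_pos h
  have e2 : L.ent v p = (L.entry v ⟨p, h⟩ : ℕ) := dif_pos h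
  rw [e1, e2, tgt, dif_pos (L.entry v ⟨p, h⟩).2]
  exact congrArg Subtype.val ((L.port (L.target v ⟨p, h⟩)).apply_symm_apply _)

theorem exists_port (L : PortLabelling G) {v w : V} (h : G.Adj v w) :
    ∃ p < G.degree v, L.tgt v p = w := by
  refine ⟨(L.port v).symm ⟨w, h⟩, Fin.is_lt _, ?_⟩
  simp [tgt, target]

end PortLabelling

/-! ### Clocked rules and their implementation with bits -/

/-- A robot of the clocked model: its node, its memory, and the port through which it entered its
node in the previous round (`0` if it did not move). -/
structure Robot (V M : Type*) where
  pos : V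
  mem : M
  entry : ℕ

/-- A rule for `k` robots that share a clock: from the time, the identifier of the robot, the
degree of its node and the memories and entry ports of the robots at the node, it determines the
new memory of the robot and the port (if any) through which it leaves. Every robot writes only
its own memory. -/
abbrev ClockedRule (k : ℕ) (M : Type*) : Type _ :=
  ℕ → Fin k → ℕ → (Fin k → Option (M × ℕ)) → M × Option ℕ

namespace ClockedRule

variable {V : Type*} [Fintype V] [DecidableEq V] {G : SimpleGraph V} [DecidableRel G.Adj]
  {k : ℕ} {M : Type*}

/-- The robots at node `v`, as seen by the robots at `v`. -/
def view (c : Fin k → Robot V M) (v : V) : Fin k → Option (M × ℕ) :=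
  fun j => if (c j).pos = v then some ((c j).mem, (c j).entry) else none

@[simp] theorem view_eq_some {c : Fin k → Robot V M} {v : V} {j : Fin k} {q : M × ℕ} :
    view c v j = some q ↔ (c j).pos = v ∧ ((c j).mem, (c j).entry) = q := by
  simp [view]

/-- The robot that results from a decision taken at node `v`. -/
def move (L : PortLabelling G) (v : V) (a : M × Option ℕ) : Robot V M :=
  match a.2 with
  | none => ⟨v, a.1, 0⟩
  | some p => ⟨L.tgt v p, a.1, L.ent v p⟩

/-- One round at time `t`. -/
def step (F : ClockedRule k M) (L : PortLabelling G) (t : ℕ) (c : Fin k → Robot V M) :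
    Fin k → Robot V M :=
  fun r => move L (c r).pos (F t r (G.degree (c r).pos) (view c (c r).pos))

/-- The configuration at time `t`. -/
def run (F : ClockedRule k M) (L : PortLabelling G) (m₀ : M) (start : Fin k → V) :
    ℕ → Fin k → Robot V M
  | 0 => fun r => ⟨start r, m₀, 0⟩
  | t + 1 => F.step L t (F.run L m₀ start t)

section Implementation

variable {N : ℕ} [Inhabited M]

/-- Decode a bit string into a memory and a clock value; `e` is the coding. -/
noncomputable def decode {b : ℕ} (e : M × Fin (N + 1) ↪ (Fin b → Bool)) :
    (Fin b → Bool) → M × Fin (N + 1) :=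
  Function.invFun e

theorem decode_apply {b : ℕ} (e : M × Fin (N + 1) ↪ (Fin b → Bool)) (x : M × Fin (N + 1)) :
    decode e (e x) = x :=
  Function.leftInverse_invFun e.injective x

/-- The view of the clocked model that corresponds to a view of the bit model. -/
noncomputable def decodeView {b : ℕ} (e : M × Fin (N + 1) ↪ (Fin b → Bool))
    (w : View k b) : Fin k → Option (M × ℕ) :=
  fun j => (w j).map fun s => ((decode e s.mem).1, (s.lastMove.map Prod.snd).getD 0)

/-- The action, in the bit model, of a robot that executes the clocked rule `F` for `N` rounds and
then halts. The coding `e` stores the memory and the clock of a robot in `b` bits. -/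
noncomputable def actionOf {b : ℕ} (F : ClockedRule k M) (e : M × Fin (N + 1) ↪ (Fin b → Bool))
    (self : Fin k) (δ : ℕ) (w : View k b) : RobotAction k b δ :=
  let clock := ((w self).map fun s => (decode e s.mem).2).getD 0
  if clock.1 < N then
    let a := F clock self δ (decodeView e w)
    { write := fun j => if j = self then some (e (a.1, Fin.ofNat (N + 1) (clock.1 + 1))) else none
      exit := a.2.bind fun p => if h : p < δ then some ⟨p, h⟩ else none }
  else ⟨fun _ => none, none⟩

/-- The robot program that executes the clocked rule `F` for `N` rounds and then halts. -/
noncomputable def toProgram {b : ℕ} (F : ClockedRule k M)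
    (e : M × Fin (N + 1) ↪ (Fin b → Bool)) : RobotProgram k where
  memBits := b
  initMem := e (default, 0)
  compute := F.actionOf e

/-- `P` executes the clocked rule `F` for `N` rounds, its bits being read through `e`. -/
structure Implements (P : RobotProgram k) (F : ClockedRule k M)
    (e : M × Fin (N + 1) ↪ (Fin P.memBits → Bool)) : Prop where
  initMem : P.initMem = e (default, 0)
  compute : P.compute = F.actionOf e

theorem implements_toProgram {b : ℕ} (F : ClockedRule k M)
    (e : M × Fin (N + 1) ↪ (Fin b → Bool)) : Implements (F.toProgram e) F e :=
  ⟨rfl, rfl⟩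

theorem findSome?_eq_of_unique {α β : Type*} {f : α → Option β} {j : α} {y : β} :
    ∀ {l : List α}, j ∈ l → f j = some y → (∀ i, i ≠ j → f i = none) → l.findSome? f = some y
  | [], h, _, _ => by simp at h
  | a :: l, h, hj, hn => by
    by_cases ha : a = j
    · subst ha; simp [hj]
    · have hl : j ∈ l := by
        rcases List.mem_cons.1 h with h | h
        · exact absurd h.symm ha
        · exact h
      simp only [List.findSome?_cons, hn a ha]
      exact findSome?_eq_of_unique hl hj hn

variable {P : RobotProgram k} {F : ClockedRule k M} {e : M × Fin (N + 1) ↪ (Fin P.memBits → Bool)}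

/-- The bit configuration `c` represents the clocked configuration `d` at time `t`. -/
def Represents (e : M × Fin (N + 1) ↪ (Fin P.memBits → Bool)) (c : RobotConfig V k P.memBits)
    (d : Fin k → Robot V M) (t : ℕ) : Prop :=
  ∀ r, c.pos r = (d r).pos ∧ (c.state r).mem = e ((d r).mem, Fin.ofNat (N + 1) t) ∧
    ((c.state r).lastMove.map Prod.snd).getD 0 = (d r).entry

theorem decodeView_viewAt {c : RobotConfig V k P.memBits} {d : Fin k → Robot V M} {t : ℕ}
    (h : Represents e c d t) (v : V) :
    decodeView e (P.viewAt c v) = view d v := by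
  funext j
  obtain ⟨h1, h2, h3⟩ := h j
  simp only [decodeView, RobotProgram.viewAt, view, ← h1]
  by_cases hv : c.pos j = v
  · simp only [hv, if_true, Option.map_some, h2, decode_apply, h3]
  · simp only [hv, if_false, Option.map_none]

theorem clock_viewAt {c : RobotConfig V k P.memBits} {d : Fin k → Robot V M} {t : ℕ}
    (h : Represents e c d t) (r : Fin k) :
    ((P.viewAt c (c.pos r) r).map fun s => (decode e s.mem).2).getD 0 = Fin.ofNat (N + 1) t := by
  obtain ⟨h1, h2, h3⟩ := h r
  simp [RobotProgram.viewAt, h2, decode_apply]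

theorem represents_round (hP : Implements P F e) (L : PortLabelling G)
    {c : RobotConfig V k P.memBits} {d : Fin k → Robot V M}
    {t : ℕ} (ht : t < N) (h : Represents e c d t) :
    Represents e (P.round L c) (F.step L t d) (t + 1) := by
  have htN : (Fin.ofNat (N + 1) t : ℕ) = t := by
    simp [Fin.ofNat, Nat.mod_eq_of_lt (show t < N + 1 by omega)]
  have hact : ∀ i : Fin k, P.action G c i =
      { write := fun j => if j = i then some (e ((F t i (G.degree (c.pos i))
            (view d (c.pos i))).1, Fin.ofNat (N + 1) (t + 1))) else none
        exit := (F t i (G.degree (c.pos i)) (view d (c.pos i))).2.bind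
          fun p => if h : p < G.degree (c.pos i) then some ⟨p, h⟩ else none } := by
    intro i
    simp only [RobotProgram.action, hP.compute, actionOf, clock_viewAt h i,
      decodeView_viewAt h (c.pos i), htN, ht, if_true]
  intro r
  have h1 := (h r).1
  have hmem : ((P.round L c).state r).mem =
      e ((F t r (G.degree (c.pos r)) (view d (c.pos r))).1, Fin.ofNat (N + 1) (t + 1)) := by
    simp only [RobotProgram.round, RobotProgram.newMem]
    rw [findSome?_eq_of_unique (j := r) (List.mem_finRange r)
      (y := e ((F t r (G.degree (c.pos r)) (view d (c.pos r))).1, Fin.ofNat (N + 1) (t + 1)))]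
    · rfl
    · simp [hact]
    · intro i hi
      have : ¬ r = i := fun h => hi h.symm
      simp [hact, this]
  have hx := congrArg RobotAction.exit (hact r)
  dsimp only at hx
  have hpos : (P.round L c).pos r = (F.step L t d r).pos ∧
      (((P.round L c).state r).lastMove.map Prod.snd).getD 0 = (F.step L t d r).entry := by
    have hstep : F.step L t d r =
        move L (c.pos r) (F t r (G.degree (c.pos r)) (view d (c.pos r))) := by rw [h1]; rfl
    simp only [RobotProgram.round, RobotProgram.newPos, RobotProgram.newMove, hx, hstep]
    cases hF : (F t r (G.degree (c.pos r)) (view d (c.pos r))).2 with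
    | none => simp [move, hF]
    | some p =>
      by_cases hp : p < G.degree (c.pos r)
      · simp [hp, move, hF, PortLabelling.tgt, PortLabelling.ent]
      · simp [hp, move, hF, PortLabelling.tgt, PortLabelling.ent]
  refine ⟨hpos.1, ?_, hpos.2⟩
  rw [hmem, h1]
  congr 2
  simp only [step, move]
  split <;> rfl

theorem represents_run (hP : Implements P F e) (L : PortLabelling G) (start : Fin k → V) {t : ℕ}
    (ht : t ≤ N) : Represents e (P.run L start t) (F.run L default start t) t := by
  induction t with
  | zero => intro r; simp [RobotProgram.run, RobotProgram.initial, hP.initMem, ClockedRule.run]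
  | succ t ih =>
    have := represents_round hP L (show t < N by omega) (ih (by omega))
    simpa only [RobotProgram.run, Function.iterate_succ', Function.comp, ClockedRule.run] using this

theorem represents_round_of_halted (hP : Implements P F e) (L : PortLabelling G)
    {c : RobotConfig V k P.memBits} {d : Fin k → Robot V M} (h : Represents e c d N) :
    Represents e (P.round L c) (fun r => { d r with entry := 0 }) N := by
  have htN : ¬ ((Fin.ofNat (N + 1) N : ℕ) < N) := by simp [Fin.ofNat]
  have hact : ∀ i : Fin k, P.action G c i = ⟨fun _ => none, none⟩ := by
    intro i
    simp only [RobotProgram.action, hP.compute, actionOf, clock_viewAt h i, htN, if_false]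
  intro r
  obtain ⟨h1, h2, h3⟩ := h r
  have hx := congrArg RobotAction.exit (hact r)
  dsimp only at hx
  refine ⟨?_, ?_, ?_⟩
  · simp only [RobotProgram.round, RobotProgram.newPos, hx, h1]
  · have : (List.finRange k).findSome?
        (fun _ : Fin k => (none : Option (Fin P.memBits → Bool))) = none := by
      rw [List.findSome?_eq_none_iff]; simp
    simp [RobotProgram.round, RobotProgram.newMem, hact, h2, this]
  · simp [RobotProgram.round, RobotProgram.newMove, hx]

/-- The program runs the clocked rule up to time `N` and keeps all positions from then on. -/
theorem pos_run_of_implements (hP : Implements P F e) (L : PortLabelling G) (start : Fin k → V)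
    (t : ℕ) :
    (P.run L start t).pos = fun r => (F.run L default start (min t N) r).pos := by
  rcases le_total t N with ht | ht
  · rw [min_eq_left ht]
    exact funext fun r => (represents_run hP L start ht r).1
  · rw [min_eq_right ht]
    obtain ⟨s, rfl⟩ := Nat.exists_eq_add_of_le ht
    have : ∃ d : Fin k → Robot V M, (∀ r, (d r).pos = (F.run L default start N r).pos) ∧
        Represents e (P.run L start (N + s)) d N := by
      clear ht
      induction s with
      | zero => exact ⟨_, fun _ => rfl, represents_run hP L start le_rfl⟩
      | succ s ih =>
        obtain ⟨d, hd, hr⟩ := ih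
        refine ⟨_, ?_, by
          simpa only [RobotProgram.run, Function.iterate_succ', Function.comp, ← add_assoc] using
            represents_round_of_halted hP L hr⟩
        exact hd
    obtain ⟨d, hd, hr⟩ := this
    exact funext fun r => (hr r).1.trans (hd r)

end Implementation

end ClockedRule

/-! ### The rules of the algorithm -/

/-- The writable memory of a robot in the clocked model. A robot is either settled at its node or
a mover. The label of a mover names its group; the label of a settled robot names the group that
owns its node. The label of the group founded at the node of robot `i` is `i.succ`; the label `0`
says that no group owns the node. A settled robot also stores the port that leads to the parent of
its node in the search tree of the owner (`none` at the root) and the number of ports of its node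
that the owner has already explored. A mover has its flag `probe` set when it has just left a node
of its group through an unexplored port. -/
structure Memo (k Δ : ℕ) where
  settled : Bool
  label : Fin (k + 1)
  parent : Option (Fin (Δ + 1))
  next : Fin (Δ + 1)
  probe : Bool

instance (k Δ : ℕ) : Inhabited (Memo k Δ) := ⟨⟨false, 0, none, 0, false⟩⟩

/-- What the robots at a node know about each other. -/
abbrev LocalView (k Δ : ℕ) : Type := Fin k → Option (Memo k Δ × ℕ)

section Rules

variable {k Δ : ℕ}

open Classical in
/-- The start of a search: at each node the robot with the largest identifier settles, and the
others, if any, form a group that bears its name. -/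
noncomputable def foundRule (self : Fin k) (w : LocalView k Δ) : Memo k Δ :=
  let top : Fin (k + 1) := (Finset.univ.filter fun j => (w j).isSome).sup Fin.succ
  ⟨decide (top = self.succ), if ∃ j, j ≠ self ∧ (w j).isSome then top else 0, none, 0, false⟩

open Classical in
/-- The rule of a settled robot during a search. If movers with a label larger than its own are
present, the largest label takes the node over. Otherwise, the robot counts the next port when
its own group is about to explore it. -/
noncomputable def settledRule (m : Memo k Δ) (δ : ℕ) (w : LocalView k Δ) : Memo k Δ :=
  if h : ∃ q : Memo k Δ × ℕ, (∃ r, w r = some q) ∧ q.1.settled = false ∧ m.label < q.1.label ∧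
      ∀ r' q', w r' = some q' → q'.1.settled = false → q'.1.label ≤ q.1.label then
    ⟨true, h.choose.1.label, some (Fin.ofNat _ h.choose.2), 0, false⟩
  else if (∃ r q, w r = some q ∧ q.1.settled = false ∧ q.1.label = m.label ∧ q.1.probe = false) ∧
      (m.next : ℕ) < δ then
    { m with next := Fin.ofNat _ (m.next + 1) }
  else m

open Classical in
/-- The rule of a mover with memory `m` and entry port `e` during a search. A mover that meets a
larger label waits. At an occupied node, a probing mover goes back if its group already owns the
node, and otherwise lets the settled robot change the owner; a mover that does not probe leaves
through the next unexplored port or, if there is none, towards the parent. At an empty node,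
if `disperse` is set, the mover with the largest identifier in the group settles; otherwise the
group goes back. -/
noncomputable def moverRule (disperse : Bool) (self : Fin k) (m : Memo k Δ) (e δ : ℕ)
    (w : LocalView k Δ) : Memo k Δ × Option ℕ :=
  if h : ∃ q : Memo k Δ × ℕ, (∃ s, w s = some q) ∧ q.1.settled = true then
    if ∃ r q', w r = some q' ∧ m.label < q'.1.label then (m, none)
    else if m.probe then
      ({ m with probe := false }, if h.choose.1.label = m.label then some e else none)
    else if (h.choose.1.next : ℕ) < δ then ({ m with probe := true }, some h.choose.1.next)
    else (m, h.choose.1.parent.map Fin.val)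
  else if disperse then
    if ∃ r q', w r = some q' ∧ m.label < q'.1.label then (m, none)
    else if ∃ r q', w r = some q' ∧ q'.1.label = m.label ∧ self < r then
      ({ m with probe := false }, none)
    else (⟨true, m.label, some (Fin.ofNat _ e), 0, false⟩, none)
  else ({ m with probe := false }, some e)

/-- The rule of all robots during a search. -/
noncomputable def searchRule (disperse : Bool) (self : Fin k) (δ : ℕ) (w : LocalView k Δ) :
    Memo k Δ × Option ℕ :=
  match w self with
  | none => (default, none)
  | some (m, e) =>
    if m.settled then (settledRule m δ w, none) else moverRule disperse self m e δ w

open Classical in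
/-- After a search that does not disperse, every mover walks to the root of the search tree; it
first goes back to an occupied node if it is not at one. -/
noncomputable def walkRule (self : Fin k) (w : LocalView k Δ) : Memo k Δ × Option ℕ :=
  match w self with
  | none => (default, none)
  | some (m, e) =>
    if m.settled then (m, none)
    else if h : ∃ q : Memo k Δ × ℕ, (∃ s, w s = some q) ∧ q.1.settled = true then
      (m, h.choose.1.parent.map Fin.val)
    else (m, some e)

end Rules

/-! ### The effect of one round -/

/-- A configuration of the algorithm. -/
abbrev Conf (V : Type*) (k Δ : ℕ) : Type _ := Fin k → Robot V (Memo k Δ)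

namespace Conf

variable {V : Type*} [Fintype V] [DecidableEq V] {G : SimpleGraph V} [DecidableRel G.Adj]
  {k Δ : ℕ}

open ClockedRule

/-- Robot `r` is settled. -/
def Settled (c : Conf V k Δ) (r : Fin k) : Prop := (c r).mem.settled = true

/-- The label of robot `r`. -/
def lab (c : Conf V k Δ) (r : Fin k) : Fin (k + 1) := (c r).mem.label

/-- The port stored by robot `r` that leads to the parent. -/
def par (c : Conf V k Δ) (r : Fin k) : Option ℕ := (c r).mem.parent.map Fin.val

/-- The number of explored ports stored by robot `r`. -/
def nxt (c : Conf V k Δ) (r : Fin k) : ℕ := (c r).mem.next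

/-- Node `v` is occupied, that is, it holds a settled robot. -/
def Occ (c : Conf V k Δ) (v : V) : Prop := ∃ s, c.Settled s ∧ (c s).pos = v

/-- Robot `r` meets a larger label at its node. -/
def Dominated (c : Conf V k Δ) (r : Fin k) : Prop :=
  ∃ r', (c r').pos = (c r).pos ∧ c.lab r < c.lab r'

/-- No node holds two settled robots. -/
def Distinct (c : Conf V k Δ) : Prop :=
  ∀ r s, c.Settled r → c.Settled s → (c r).pos = (c s).pos → r = s

/-- The configuration at the start of a search, which depends on the positions only. -/
noncomputable def found (c : Conf V k Δ) : Conf V k Δ :=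
  fun r => ⟨(c r).pos, foundRule r (view c (c r).pos), 0⟩

/-- One round of a search. -/
noncomputable def search (disperse : Bool) (L : PortLabelling G) (c : Conf V k Δ) : Conf V k Δ :=
  fun r => move L (c r).pos (searchRule disperse r (G.degree (c r).pos) (view c (c r).pos))

/-- One round of the walk to the roots. -/
noncomputable def walk (L : PortLabelling G) (c : Conf V k Δ) : Conf V k Δ :=
  fun r => move L (c r).pos (walkRule r (view c (c r).pos))

variable {c : Conf V k Δ} {L : PortLabelling G} {d : Bool} {r z : Fin k}

theorem view_self (c : Conf V k Δ) (r : Fin k) :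
    view c (c r).pos r = some ((c r).mem, (c r).entry) := by simp

theorem search_settled (hr : c.Settled r) :
    search d L c r = ⟨(c r).pos, settledRule (c r).mem (G.degree (c r).pos)
      (view c (c r).pos), 0⟩ := by
  have hr' : (c r).mem.settled = true := hr
  simp only [search, searchRule, view_self, hr', if_true, move]

theorem search_mover (hr : ¬ c.Settled r) :
    search d L c r = move L (c r).pos (moverRule d r (c r).mem (c r).entry
      (G.degree (c r).pos) (view c (c r).pos)) := by
  have hr' : ¬ (c r).mem.settled = true := hr
  simp only [search, searchRule, view_self, hr', if_false, Bool.false_eq_true]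

theorem exists_settled_iff (v : V) :
    (∃ q : Memo k Δ × ℕ, (∃ s, view c v s = some q) ∧ q.1.settled = true) ↔ c.Occ v := by
  constructor
  · rintro ⟨q, ⟨s, hs⟩, hq⟩
    rw [view_eq_some] at hs
    obtain ⟨h1, rfl⟩ := hs
    exact ⟨s, hq, h1⟩
  · rintro ⟨s, hs, h1⟩
    exact ⟨((c s).mem, (c s).entry), ⟨s, by simp [h1]⟩, hs⟩

theorem dominated_iff :
    (∃ r' q', view c (c r).pos r' = some q' ∧ (c r).mem.label < q'.1.label) ↔ c.Dominated r := by
  constructor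
  · rintro ⟨r', q, hs, hq⟩
    rw [view_eq_some] at hs
    obtain ⟨h1, rfl⟩ := hs
    exact ⟨r', h1, hq⟩
  · rintro ⟨s, h1, hs⟩
    exact ⟨s, ((c s).mem, (c s).entry), by simp [h1], hs⟩

theorem settled_search (hr : c.Settled r) : (search d L c).Settled r := by
  have hr' : (c r).mem.settled = true := hr
  rw [Settled, search_settled hr]
  simp only [settledRule]
  split_ifs <;> simp [hr']

theorem pos_search_settled (hr : c.Settled r) : (search d L c r).pos = (c r).pos := by
  rw [search_settled hr]

/-- A settled robot either passes to the largest label among the movers at its node, provided that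
it exceeds its own, or keeps its label and parent. -/
theorem search_settled_cases (hr : c.Settled r) :
    (∃ r₀, ¬ c.Settled r₀ ∧ (c r₀).pos = (c r).pos ∧ c.lab r < c.lab r₀ ∧
      (∀ r', ¬ c.Settled r' → (c r').pos = (c r).pos → c.lab r' ≤ c.lab r₀) ∧
      (search d L c r).mem = ⟨true, c.lab r₀, some (Fin.ofNat _ (c r₀).entry), 0, false⟩) ∨
    ((∀ r', ¬ c.Settled r' → (c r').pos = (c r).pos → c.lab r' ≤ c.lab r) ∧
      (search d L c).lab r = c.lab r ∧ (search d L c).par r = c.par r ∧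
      (((∃ r', ¬ c.Settled r' ∧ (c r').pos = (c r).pos ∧ c.lab r' = c.lab r ∧
          (c r').mem.probe = false) ∧ c.nxt r < G.degree (c r).pos) →
        (search d L c r).mem.next = Fin.ofNat _ (c.nxt r + 1)) ∧
      (¬ ((∃ r', ¬ c.Settled r' ∧ (c r').pos = (c r).pos ∧ c.lab r' = c.lab r ∧
          (c r').mem.probe = false) ∧ c.nxt r < G.degree (c r).pos) →
        (search d L c).nxt r = c.nxt r)) := by
  classical
  rw [search_settled hr]
  by_cases h : ∃ q : Memo k Δ × ℕ, (∃ r', view c (c r).pos r' = some q) ∧ q.1.settled = false ∧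
      (c r).mem.label < q.1.label ∧ ∀ r' q', view c (c r).pos r' = some q' →
        q'.1.settled = false → q'.1.label ≤ q.1.label
  · left
    obtain ⟨⟨r₀, hr₀⟩, h2, h3, h4⟩ := h.choose_spec
    rw [view_eq_some] at hr₀
    obtain ⟨h0, h1⟩ := hr₀
    rw [← h1] at h2 h3 h4
    refine ⟨r₀, by simpa [Settled] using h2, h0, h3, ?_, ?_⟩
    · intro r' hs hp
      exact h4 r' ((c r').mem, (c r').entry) (by simp [hp]) (by simpa [Settled] using hs)
    · simp only [settledRule]
      rw [dif_pos h, ← h1]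
      rfl
  · right
    have hle : ∀ r', ¬ c.Settled r' → (c r').pos = (c r).pos → c.lab r' ≤ c.lab r := by
      by_contra! hcon
      obtain ⟨r₁, hr₁, hp₁, hl₁⟩ := hcon
      obtain ⟨r₂, hr₂, hmax⟩ := Finset.exists_max_image
        (Finset.univ.filter fun r' => ¬ c.Settled r' ∧ (c r').pos = (c r).pos) c.lab
        ⟨r₁, by simp [hr₁, hp₁]⟩
      simp only [Finset.mem_filter, Finset.mem_univ, true_and] at hr₂ hmax
      refine h ⟨((c r₂).mem, (c r₂).entry), ⟨r₂, by simp [hr₂.2]⟩, by simpa [Settled] using hr₂.1,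
        lt_of_lt_of_le hl₁ (hmax r₁ ⟨hr₁, hp₁⟩), ?_⟩
      intro r' q' hq' hs
      rw [view_eq_some] at hq'
      obtain ⟨h1, rfl⟩ := hq'
      exact hmax r' ⟨by simpa [Settled] using hs, h1⟩
    have hiff : (∃ r' q, view c (c r).pos r' = some q ∧ q.1.settled = false ∧
        q.1.label = (c r).mem.label ∧ q.1.probe = false) ↔ ∃ r', ¬ c.Settled r' ∧
        (c r').pos = (c r).pos ∧ c.lab r' = c.lab r ∧ (c r').mem.probe = false := by
      constructor
      · rintro ⟨r', q, hq, h1, h2, h3⟩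
        rw [view_eq_some] at hq
        obtain ⟨h4, rfl⟩ := hq
        exact ⟨r', by simpa [Settled] using h1, h4, h2, h3⟩
      · rintro ⟨r', h1, h2, h3, h4⟩
        exact ⟨r', ((c r').mem, (c r').entry), by simp [h2], by simpa [Settled] using h1, h3, h4⟩
    refine ⟨hle, ?_⟩
    rw [← hiff]
    simp only [lab, par, nxt, search_settled hr, settledRule]
    rw [dif_neg h]
    split_ifs with hif
    · exact ⟨rfl, rfl, fun _ => rfl, fun hn => absurd hif hn⟩
    · exact ⟨rfl, rfl, fun hp => absurd hp hif, fun _ => rfl⟩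

/-- What a mover does at an occupied node. -/
theorem search_mover_occ (hc : c.Distinct) (hr : ¬ c.Settled r) (hz : c.Settled z)
    (hp : (c z).pos = (c r).pos) [Decidable (c.Dominated r)] :
    search d L c r = move L (c r).pos
      (if c.Dominated r then ((c r).mem, none)
      else if (c r).mem.probe then ({ (c r).mem with probe := false },
        if c.lab z = c.lab r then some (c r).entry else none)
      else if c.nxt z < G.degree (c r).pos then ({ (c r).mem with probe := true }, some (c.nxt z))
      else ((c r).mem, c.par z)) := by
  classical
  have h : ∃ q : Memo k Δ × ℕ, (∃ s, view c (c r).pos s = some q) ∧ q.1.settled = true :=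
    (exists_settled_iff _).2 ⟨z, hz, hp⟩
  obtain ⟨⟨s, hs⟩, hq⟩ := h.choose_spec
  rw [view_eq_some] at hs
  obtain ⟨h1, h2⟩ := hs
  rw [← h2] at hq
  have hsz : s = z := hc s z hq hz (h1.trans hp.symm)
  subst hsz
  rw [search_mover hr, moverRule, dif_pos h, ← h2]
  simp only [dominated_iff]
  rfl

theorem search_mover_gather (hr : ¬ c.Settled r) (ho : ¬ c.Occ (c r).pos) :
    search false L c r = move L (c r).pos ({ (c r).mem with probe := false },
      some (c r).entry) := by
  rw [search_mover hr, moverRule, dif_neg (by rwa [exists_settled_iff])]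
  simp

/-- At an empty node of a dispersing search, exactly one of the robots with the largest label
settles. -/
theorem search_mover_disperse (hr : ¬ c.Settled r) (ho : ¬ c.Occ (c r).pos)
    [Decidable (c.Dominated r)]
    [Decidable (∃ r', (c r').pos = (c r).pos ∧ c.lab r' = c.lab r ∧ r < r')] :
    search true L c r =
      if c.Dominated r then ⟨(c r).pos, (c r).mem, 0⟩
      else if ∃ r', (c r').pos = (c r).pos ∧ c.lab r' = c.lab r ∧ r < r' then
        ⟨(c r).pos, { (c r).mem with probe := false }, 0⟩
      else ⟨(c r).pos, ⟨true, c.lab r, some (Fin.ofNat _ (c r).entry), 0, false⟩, 0⟩ := by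
  classical
  have hiff : (∃ r' q', view c (c r).pos r' = some q' ∧ q'.1.label = (c r).mem.label ∧ r < r') ↔
      ∃ r', (c r').pos = (c r).pos ∧ c.lab r' = c.lab r ∧ r < r' := by
    constructor
    · rintro ⟨r', q, hq, h1, h2⟩
      rw [view_eq_some] at hq
      obtain ⟨h4, rfl⟩ := hq
      exact ⟨r', h4, h1, h2⟩
    · rintro ⟨r', h1, h2, h3⟩
      exact ⟨r', ((c r').mem, (c r').entry), by simp [h1], h2, h3⟩
  rw [search_mover hr, moverRule, dif_neg (by rwa [exists_settled_iff])]
  simp only [dominated_iff, hiff, if_true]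
  split_ifs <;> rfl

/-- A mover at an occupied node stays a mover of the same group, and it either stays or moves to
a neighbour. -/
theorem search_mover_occ_cases (hc : c.Distinct) (hr : ¬ c.Settled r) (ho : c.Occ (c r).pos) :
    ¬ (search d L c).Settled r ∧ (search d L c).lab r = c.lab r ∧
      ((search d L c r).pos = (c r).pos ∨ ∃ p < G.degree (c r).pos,
        (search d L c r).pos = L.tgt (c r).pos p ∧
        (search d L c r).entry = L.ent (c r).pos p) := by
  classical
  obtain ⟨z, hz, hp⟩ := ho
  have key : ∀ a : Memo k Δ × Option ℕ, a.1.settled = (c r).mem.settled →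
      a.1.label = (c r).mem.label → search d L c r = move L (c r).pos a →
      ¬ (search d L c).Settled r ∧ (search d L c).lab r = c.lab r ∧
      ((search d L c r).pos = (c r).pos ∨ ∃ p < G.degree (c r).pos,
        (search d L c r).pos = L.tgt (c r).pos p ∧
        (search d L c r).entry = L.ent (c r).pos p) := by
    rintro ⟨m, o⟩ h1 h2 h3
    dsimp only at h1 h2
    unfold Settled lab
    rw [h3]
    have hr' : ¬ (c r).mem.settled = true := hr
    cases o with
    | none => exact ⟨by simpa [move, h1] using hr', h2, Or.inl rfl⟩
    | some p =>
      refine ⟨by simpa [move, h1] using hr', h2, ?_⟩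
      by_cases hp : p < G.degree (c r).pos
      · exact Or.inr ⟨p, hp, rfl, rfl⟩
      · left; simp [move, PortLabelling.tgt, hp]
  refine key _ ?_ ?_ (search_mover_occ hc hr hz hp)
  · split_ifs <;> rfl
  · split_ifs <;> rfl

theorem lab_search_mover (hc : c.Distinct) (hr : ¬ c.Settled r) :
    (search d L c).lab r = c.lab r := by
  classical
  by_cases ho : c.Occ (c r).pos
  · exact (search_mover_occ_cases hc hr ho).2.1
  · cases d with
    | false => rw [lab, search_mover_gather hr ho]; rfl
    | true => rw [lab, search_mover_disperse hr ho]; split_ifs <;> rfl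

/-- A robot settles only at an empty node of a dispersing search. -/
theorem settle_cases (hc : c.Distinct) (hr : ¬ c.Settled r) (hs : (search d L c).Settled r) :
    d = true ∧ ¬ c.Occ (c r).pos ∧ ¬ c.Dominated r ∧
      (∀ r', (c r').pos = (c r).pos → c.lab r' = c.lab r → r' ≤ r) ∧
      search d L c r = ⟨(c r).pos, ⟨true, c.lab r, some (Fin.ofNat _ (c r).entry), 0, false⟩,
        0⟩ := by
  classical
  by_cases ho : c.Occ (c r).pos
  · exact absurd hs (search_mover_occ_cases hc hr ho).1
  · have hr' : ¬ (c r).mem.settled = true := hr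
    cases d with
    | false =>
      rw [Settled, search_mover_gather hr ho] at hs
      exact absurd hs hr'
    | true =>
      have hx := search_mover_disperse (L := L) hr ho
      rw [Settled, hx] at hs
      split_ifs at hs hx with h1 h2
      · exact absurd hs hr'
      · exact absurd hs hr'
      · refine ⟨rfl, ho, h1, ?_, hx⟩
        intro r' hp hl
        by_contra! hlt
        exact h2 ⟨r', hp, hl, hlt⟩

theorem distinct_search (hc : c.Distinct) : (search d L c).Distinct := by
  intro r s hr hs hp
  by_cases hr0 : c.Settled r <;> by_cases hs0 : c.Settled s
  · rw [pos_search_settled hr0, pos_search_settled hs0] at hp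
    exact hc r s hr0 hs0 hp
  · obtain ⟨-, h1, -, -, h2⟩ := settle_cases hc hs0 hs
    rw [pos_search_settled hr0, h2] at hp
    exact absurd ⟨r, hr0, hp⟩ h1
  · obtain ⟨-, h1, -, -, h2⟩ := settle_cases hc hr0 hr
    rw [pos_search_settled hs0, h2] at hp
    exact absurd ⟨s, hs0, hp.symm⟩ h1
  · obtain ⟨-, -, h1, h2, h3⟩ := settle_cases hc hr0 hr
    obtain ⟨-, -, h1', h2', h3'⟩ := settle_cases hc hs0 hs
    rw [h3, h3'] at hp
    dsimp only at hp
    have hl : c.lab s = c.lab r := by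
      apply le_antisymm
      · by_contra! h; exact h1 ⟨s, hp.symm, h⟩
      · by_contra! h; exact h1' ⟨r, hp, h⟩
    exact le_antisymm (h2' r hp hl.symm) (h2 s hp.symm hl)

theorem occ_search {v : V} (h : c.Occ v) : (search d L c).Occ v := by
  obtain ⟨s, hs, hv⟩ := h
  exact ⟨s, settled_search hs, (pos_search_settled hs).trans hv⟩

/-- In a dispersing search, all nodes with robots are occupied one round later. -/
theorem occ_search_disperse (r : Fin k) : (search true L c).Occ (c r).pos := by
  classical
  by_cases ho : c.Occ (c r).pos
  · exact occ_search ho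
  · -- the mover that settles: the largest label at the node, then the largest identifier
    obtain ⟨s, hs, hmax⟩ := Finset.exists_max_image
      (Finset.univ.filter fun r' => (c r').pos = (c r).pos)
      (fun r' => toLex (c.lab r', r')) ⟨r, by simp⟩
    simp only [Finset.mem_filter, Finset.mem_univ, true_and] at hs hmax
    have hs0 : ¬ c.Settled s := fun h => ho ⟨s, h, hs⟩
    have hx := search_mover_disperse (L := L) hs0 (by rwa [hs])
    rw [if_neg, if_neg] at hx
    · exact ⟨s, by rw [Settled, hx], by rw [hx]; exact hs⟩
    · rintro ⟨r', h1, h2, h3⟩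
      have := hmax r' (h1.trans hs)
      rw [Prod.Lex.toLex_le_toLex] at this
      rcases this with h | ⟨-, h⟩
      · exact absurd h2 (ne_of_lt h)
      · exact absurd h3 (not_lt.2 h)
    · rintro ⟨r', h1, h2⟩
      have := hmax r' (h1.trans hs)
      rw [Prod.Lex.toLex_le_toLex] at this
      rcases this with h | ⟨h, -⟩
      · exact absurd h2 (not_lt.2 h.le)
      · exact absurd h.symm (ne_of_lt h2)

theorem pos_search_empty_disperse (hr : ¬ c.Settled r) (ho : ¬ c.Occ (c r).pos) :
    (search true L c r).pos = (c r).pos := by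
  classical
  rw [search_mover_disperse hr ho]
  split_ifs <;> rfl

theorem occ_search_gather {v : V} (hc : c.Distinct) : (search false L c).Occ v ↔ c.Occ v := by
  refine ⟨?_, occ_search⟩
  rintro ⟨s, hs, hv⟩
  by_cases hs0 : c.Settled s
  · exact ⟨s, hs0, by rw [← hv, pos_search_settled hs0]⟩
  · exact absurd (settle_cases hc hs0 hs).1 (by simp)

end Conf

/-! ### Components of the occupied nodes -/

/-- `v` and `w` are joined by a walk all of whose nodes satisfy `S` (or are equal). -/
def Linked {V : Type*} (G : SimpleGraph V) (S : V → Prop) : V → V → Prop :=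
  Relation.ReflTransGen fun a b => G.Adj a b ∧ S a ∧ S b

namespace Linked

variable {V : Type*} {G : SimpleGraph V} {S S' : V → Prop} {u v w : V}

theorem refl (v : V) : Linked G S v v := Relation.ReflTransGen.refl

theorem trans (h : Linked G S u v) (h' : Linked G S v w) : Linked G S u w :=
  Relation.ReflTransGen.trans h h'

theorem symm (h : Linked G S u v) : Linked G S v u := by
  induction h with
  | refl => exact refl _
  | tail _ h ih => exact Relation.ReflTransGen.head ⟨h.1.symm, h.2.2, h.2.1⟩ ih

theorem mono (hS : ∀ v, S v → S' v) (h : Linked G S u v) : Linked G S' u v := by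
  induction h with
  | refl => exact refl _
  | tail _ h ih => exact Relation.ReflTransGen.tail ih ⟨h.1, hS _ h.2.1, hS _ h.2.2⟩

theorem single (h : G.Adj u v) (hu : S u) (hv : S v) : Linked G S u v :=
  Relation.ReflTransGen.single ⟨h, hu, hv⟩

end Linked

namespace Conf

variable {V : Type*} [Fintype V] [DecidableEq V] {G : SimpleGraph V} [DecidableRel G.Adj]
  {k Δ : ℕ} {c : Conf V k Δ} {L : PortLabelling G} {d : Bool} {r z : Fin k}

open ClockedRule

/-! ### The start of a search -/

theorem pos_found (r : Fin k) : (c.found r).pos = (c r).pos := rfl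

/-- The robot with the largest identifier at a node founds the group of the node. -/
theorem exists_founder (c : Conf V k Δ) (r : Fin k) :
    ∃ j, (c j).pos = (c r).pos ∧ (∀ r', (c r').pos = (c r).pos → r' ≤ j) ∧
      ∀ r', (c r').pos = (c r).pos → ((c.found.Settled r' ↔ r' = j) ∧
        ((∃ r'' ≠ r', (c r'').pos = (c r).pos) → c.found.lab r' = j.succ) ∧
        ((¬ ∃ r'' ≠ r', (c r'').pos = (c r).pos) → c.found.lab r' = 0)) := by
  classical
  obtain ⟨j, hj, hmax⟩ := Finset.exists_max_image
    (Finset.univ.filter fun r' => (c r').pos = (c r).pos) id ⟨r, by simp⟩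
  simp only [Finset.mem_filter, Finset.mem_univ, true_and, id] at hj hmax
  have hview : ∀ a, (view c (c r).pos a).isSome = true ↔ (c a).pos = (c r).pos := by
    intro a; simp [view]
  have hsup : (Finset.univ.filter fun a => (view c (c r).pos a).isSome).sup Fin.succ =
      j.succ := by
    apply le_antisymm
    · refine Finset.sup_le fun a ha => ?_
      simp only [Finset.mem_filter, Finset.mem_univ, true_and, hview] at ha
      exact Fin.succ_le_succ_iff.2 (hmax a ha)
    · exact Finset.le_sup (f := Fin.succ) (by simp [hview, hj])
  refine ⟨j, hj, hmax, fun r' hr' => ⟨?_, ?_, ?_⟩⟩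
  · simp only [Settled, found, foundRule, hr', hsup]
    simp [eq_comm]
  · intro h
    simp only [lab, found, foundRule, hr', hsup]
    rw [if_pos (by simpa only [hview] using h)]
  · intro h
    simp only [lab, found, foundRule, hr', hsup]
    rw [if_neg (by simpa only [hview] using h)]

theorem distinct_found (c : Conf V k Δ) : c.found.Distinct := by
  intro r s hr hs hp
  obtain ⟨j, hj, -, h⟩ := exists_founder c r
  rw [(h r rfl).1.1 hr, (h s hp.symm).1.1 hs]

theorem occ_found {v : V} : c.found.Occ v ↔ ∃ r, (c r).pos = v := by
  constructor
  · rintro ⟨s, -, h⟩; exact ⟨s, h⟩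
  · rintro ⟨r, rfl⟩
    obtain ⟨j, hj, -, h⟩ := exists_founder c r
    exact ⟨j, (h j hj).1.2 rfl, hj⟩

theorem lab_found_eq_succ {j : Fin k} (h : c.found.lab r = j.succ) :
    c.found.Settled j ∧ (c j).pos = (c r).pos ∧ c.found.lab j = j.succ ∧
      ∃ r', ¬ c.found.Settled r' ∧ (c r').pos = (c j).pos ∧ c.found.lab r' = j.succ := by
  obtain ⟨a, ha, -, hf⟩ := exists_founder c r
  obtain ⟨h1, h2, h3⟩ := hf r rfl
  by_cases hr : ∃ r'' ≠ r, (c r'').pos = (c r).pos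
  · have : a = j := Fin.succ_injective _ ((h2 hr).symm.trans h)
    subst this
    -- the founder shares its node with another robot
    obtain ⟨b, hb, hbp⟩ : ∃ b ≠ a, (c b).pos = (c r).pos := by
      by_cases hra : r = a
      · subst hra; exact hr
      · exact ⟨r, hra, rfl⟩
    refine ⟨(hf a ha).1.2 rfl, ha, (hf a ha).2.1 ⟨b, hb, hbp⟩, b, ?_, hbp.trans ha.symm, ?_⟩
    · rw [(hf b hbp).1]; exact hb
    · exact (hf b hbp).2.1 ⟨a, hb.symm, ha⟩
  · rw [h3 hr] at h
    exact absurd h.symm (Fin.succ_ne_zero j)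

theorem exists_lab_found (hr : ¬ c.found.Settled r) : ∃ j : Fin k, c.found.lab r = j.succ := by
  obtain ⟨a, ha, -, hf⟩ := exists_founder c r
  refine ⟨a, (hf r rfl).2.1 ⟨a, ?_, ha⟩⟩
  rintro rfl
  exact hr ((hf a rfl).1.2 rfl)

/-! ### Groups stay in their component -/

/-- Every robot with the label of group `j`, founded at the node `p j`, is in the component of
`p j` in the graph of occupied nodes, or has just left it for an empty node. `R` is the set of the
groups that were founded. -/
def Tied (G : SimpleGraph V) [DecidableRel G.Adj] (L : PortLabelling G) (p : Fin k → V)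
    (R : Fin k → Prop) (c : Conf V k Δ) : Prop :=
  ∀ r j, c.lab r = Fin.succ j → R j ∧
    (c.Occ (c r).pos → Linked G c.Occ (p j) (c r).pos) ∧
    (¬ c.Occ (c r).pos → (c r).entry < G.degree (c r).pos ∧
      c.Occ (L.tgt (c r).pos (c r).entry) ∧
      Linked G c.Occ (p j) (L.tgt (c r).pos (c r).entry))

theorem tied_found (L : PortLabelling G) (c : Conf V k Δ) :
    c.found.Tied G L (fun j => (c j).pos) (fun j => c.found.lab j = j.succ) := by
  intro r j h
  obtain ⟨-, h2, h3, -⟩ := lab_found_eq_succ h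
  refine ⟨h3, fun _ => ?_, fun ho => absurd (occ_found.2 ⟨r, rfl⟩) ho⟩
  rw [pos_found, ← h2]
  exact Linked.refl _

theorem tied_search {p : Fin k → V} {R : Fin k → Prop} (hc : c.Distinct)
    (h : c.Tied G L p R) : (search d L c).Tied G L p R := by
  have hmono : ∀ v, c.Occ v → (search d L c).Occ v := fun v => occ_search
  intro r j hj
  by_cases hr : c.Settled r
  · have hpos := pos_search_settled (d := d) (L := L) hr
    have hocc : c.Occ (c r).pos := ⟨r, hr, rfl⟩
    have hl : ∃ r₀, (c r₀).pos = (c r).pos ∧ c.lab r₀ = j.succ := by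
      rcases search_settled_cases (d := d) (L := L) hr with ⟨r₀, -, h1, -, -, h2⟩ | ⟨-, h1, -⟩
      · refine ⟨r₀, h1, ?_⟩
        rw [lab, h2] at hj
        exact hj
      · exact ⟨r, rfl, h1.symm.trans hj⟩
    obtain ⟨r₀, hp₀, hl₀⟩ := hl
    obtain ⟨h1, h2, -⟩ := h r₀ j hl₀
    rw [hp₀] at h2
    rw [hpos]
    exact ⟨h1, fun _ => (h2 hocc).mono hmono, fun ho => absurd (hmono _ hocc) ho⟩
  · rw [lab_search_mover hc hr] at hj
    obtain ⟨h1, h2, h3⟩ := h r j hj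
    refine ⟨h1, ?_⟩
    by_cases ho : c.Occ (c r).pos
    · have h2 := (h2 ho).mono hmono
      obtain ⟨-, -, hm | ⟨q, hq, hm, he⟩⟩ := search_mover_occ_cases (d := d) (L := L) hc hr ho
      · rw [hm]
        exact ⟨fun _ => h2, fun ho' => absurd (hmono _ ho) ho'⟩
      · rw [hm, he, L.tgt_ent hq]
        exact ⟨fun ho' => h2.trans (Linked.single (L.adj_tgt hq) (hmono _ ho) ho'),
          fun _ => ⟨L.ent_lt hq, hmono _ ho, h2⟩⟩
    · obtain ⟨h3, h4, h5⟩ := h3 ho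
      cases d with
      | false =>
        have hm := search_mover_gather (L := L) hr ho
        have hm' : (search false L c r).pos = L.tgt (c r).pos (c r).entry := by rw [hm]; rfl
        rw [hm']
        exact ⟨fun _ => h5.mono hmono, fun ho' => absurd (hmono _ h4) ho'⟩
      | true =>
        have ho' := occ_search_disperse (L := L) (c := c) r
        rw [pos_search_empty_disperse hr ho]
        exact ⟨fun _ => (h5.mono hmono).trans
          (Linked.single (L.adj_tgt h3).symm (hmono _ h4) ho'), fun hn => absurd ho' hn⟩

end Conf

namespace Conf

variable {V : Type*} [Fintype V] [DecidableEq V] {G : SimpleGraph V} [DecidableRel G.Adj]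
  {k Δ : ℕ} {c c' : Conf V k Δ} {L : PortLabelling G} {d : Bool} {i s z : Fin k}
  {rest : List (Fin k)} {h : V} {b : Bool} {e : ℕ}

open ClockedRule

/-! ### The search of a group that meets no larger label -/

open Classical in
/-- The settled robots at the nodes owned by group `i`. -/
noncomputable def owned (c : Conf V k Δ) (i : Fin k) : Finset (Fin k) :=
  Finset.univ.filter fun r => c.Settled r ∧ c.lab r = i.succ

theorem mem_owned {r : Fin k} : r ∈ c.owned i ↔ c.Settled r ∧ c.lab r = i.succ := by
  simp [owned]

/-- Robot `r` is a mover of group `i`. -/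
def Mover (c : Conf V k Δ) (i r : Fin k) : Prop := ¬ c.Settled r ∧ c.lab r = i.succ

/-- Group `i` meets no larger label. Encounters at empty nodes matter only if the search
disperses. -/
def Undominated (d : Bool) (c : Conf V k Δ) (i : Fin k) : Prop :=
  ∀ r r', c.lab r = i.succ → (c r').pos = (c r).pos → (d = true ∨ c.Occ (c r).pos) →
    c.lab r' ≤ i.succ

/-- The stored ports lead in `n` steps from the node of `x` to the node of `y`, through nodes
owned by group `i`. -/
def ParentPath (L : PortLabelling G) (c : Conf V k Δ) (i : Fin k) : ℕ → Fin k → Fin k → Prop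
  | 0, x, y => x = y
  | n + 1, x, y => ∃ p z, c.par x = some p ∧ z ∈ c.owned i ∧ (c z).pos = L.tgt (c x).pos p ∧
      ParentPath L c i n z y

/-- The invariant of the depth-first search of group `i`. The stack `s :: rest` holds the settled
robots on the tree path from the current node up to the root, which is the node of robot `i`. The
movers of the group are at node `h` with probe flag `b`; if they probe, `h` is reached from the
node of `s` and `e` is the port of `h` that leads back. Owned nodes off the stack are completely
explored, and every explored port leads to an owned node, to an empty node (if the search does not
disperse) or to the node that is being probed. -/
structure SearchInv (d : Bool) (L : PortLabelling G) (c : Conf V k Δ) (i s : Fin k)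
    (rest : List (Fin k)) (h : V) (b : Bool) (e : ℕ) : Prop where
  mover : ∃ r, c.Mover i r
  head : ∀ r, c.Mover i r → (c r).pos = h ∧ (c r).mem.probe = b ∧ (b = true → (c r).entry = e)
  stack_owned : ∀ x ∈ s :: rest, x ∈ c.owned i
  nodup : (s :: rest).Nodup
  chain : (s :: rest).IsChain fun x y => ∃ p, c.par x = some p ∧ L.tgt (c x).pos p = (c y).pos
  last : (s :: rest).getLast (by simp) = i
  root : c.par i = none
  finished : ∀ x ∈ c.owned i, x ∉ s :: rest → c.nxt x = G.degree (c x).pos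
  nxt_le : ∀ x ∈ c.owned i, c.nxt x ≤ G.degree (c x).pos
  explored : ∀ x ∈ c.owned i, ∀ p < c.nxt x, (∃ y ∈ c.owned i, (c y).pos = L.tgt (c x).pos p) ∨
    (d = false ∧ ¬ c.Occ (L.tgt (c x).pos p)) ∨ (b = true ∧ L.tgt (c x).pos p = h)
  at_top : b = false → h = (c s).pos
  at_probe : b = true → e < G.degree h ∧ L.tgt h e = (c s).pos
  tree : ∀ x ∈ c.owned i, ∃ n < (c.owned i).card, ParentPath L c i n x i

/-- The measure of progress of group `i`. -/
noncomputable def weight (c : Conf V k Δ) (i : Fin k) : ℕ :=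
  2 * ∑ x ∈ c.owned i, c.nxt x + (c.owned i).card

/-- Nothing but the number of explored ports has changed at the nodes owned by group `i`. -/
def Keeps (i : Fin k) (c c' : Conf V k Δ) : Prop :=
  ∀ x ∈ c.owned i, x ∈ c'.owned i ∧ (c' x).pos = (c x).pos ∧ c'.par x = c.par x

theorem ParentPath.keep (hk : Keeps i c c') {n : ℕ} {x y : Fin k} (hx : x ∈ c.owned i)
    (hp : ParentPath L c i n x y) : ParentPath L c' i n x y := by
  induction n generalizing x with
  | zero => exact hp
  | succ n ih =>
    obtain ⟨p, z, h1, h2, h3, h4⟩ := hp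
    obtain ⟨k1, k2, k3⟩ := hk x hx
    obtain ⟨l1, l2, l3⟩ := hk z h2
    exact ⟨p, z, k3.trans h1, l1, by rw [l2, k2, h3], ih h2 h4⟩

theorem chain_keep (hk : Keeps i c c') : ∀ {l : List (Fin k)}, (∀ x ∈ l, x ∈ c.owned i) →
    (l.IsChain fun x y => ∃ p, c.par x = some p ∧ L.tgt (c x).pos p = (c y).pos) →
    l.IsChain fun x y => ∃ p, c'.par x = some p ∧ L.tgt (c' x).pos p = (c' y).pos
  | [], _, _ => .nil
  | [_], _, _ => .singleton _
  | x :: y :: l, hl, hc => by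
    rw [List.isChain_cons_cons] at hc ⊢
    obtain ⟨⟨p, h1, h2⟩, h3⟩ := hc
    obtain ⟨-, k2, k3⟩ := hk x (hl x (by simp))
    obtain ⟨-, l2, -⟩ := hk y (hl y (by simp))
    exact ⟨⟨p, k3.trans h1, by rw [k2, l2, h2]⟩,
      chain_keep hk (fun a ha => hl a (List.mem_cons_of_mem _ ha)) h3⟩

/-- The invariant after a round in which the group returns to an owned node: it goes back from
the probed node, or backtracks from a completely explored node, or stays at the root. -/
theorem SearchInv.of_return (H : SearchInv d L c i s rest h b e) (hk : Keeps i c c')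
    (ho : c'.owned i = c.owned i) (hn : ∀ x ∈ c.owned i, c'.nxt x = c.nxt x)
    (hocc : d = false → ∀ v, c'.Occ v → c.Occ v)
    {s' : Fin k} {rest' : List (Fin k)}
    (hs : s' :: rest' = s :: rest ∨ (s' :: rest' = rest ∧ c.nxt s = G.degree (c s).pos))
    (hm : ∃ r, c'.Mover i r)
    (hh : ∀ r, c'.Mover i r → (c' r).pos = (c s').pos ∧ (c' r).mem.probe = false)
    (hb : b = true → (∃ y ∈ c.owned i, (c y).pos = h) ∨ (d = false ∧ ¬ c.Occ h)) :
    SearchInv d L c' i s' rest' (c s').pos false 0 ∧ c'.weight i = c.weight i := by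
  have hsub : ∀ x ∈ s' :: rest', x ∈ s :: rest := by
    rcases hs with hs | ⟨hs, -⟩
    · rw [hs]; exact fun x hx => hx
    · rw [hs]; exact fun x hx => List.mem_cons_of_mem _ hx
  have hown : ∀ x ∈ s' :: rest', x ∈ c.owned i := fun x hx => H.stack_owned x (hsub x hx)
  have hpos : ∀ x ∈ c.owned i, (c' x).pos = (c x).pos := fun x hx => (hk x hx).2.1
  have hi : i ∈ c.owned i := by
    have := H.stack_owned _ (List.getLast_mem (l := s :: rest) (by simp))
    rwa [H.last] at this
  refine ⟨{ mover := hm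
            head := fun r hr => ⟨(hh r hr).1, (hh r hr).2, by simp⟩
            stack_owned := fun x hx => ho ▸ hown x hx
            nodup := ?_, chain := ?_, last := ?_, root := ?_, finished := ?_, nxt_le := ?_
            explored := ?_
            at_top := fun _ => (hpos s' (hown s' (by simp))).symm
            at_probe := by simp, tree := ?_ }, ?_⟩
  · rcases hs with hs | ⟨hs, -⟩
    · rw [hs]; exact H.nodup
    · rw [hs]; exact H.nodup.of_cons
  · refine chain_keep hk hown ?_
    rcases hs with hs | ⟨hs, -⟩
    · rw [hs]; exact H.chain
    · rw [hs]; exact H.chain.tail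
  · rcases hs with hs | ⟨hs, -⟩
    · rw [← H.last]; simp only [hs]
    · rw [← H.last]; subst hs; simp
  · rw [(hk i hi).2.2, H.root]
  · intro x hx hx'
    rw [ho] at hx
    rw [hn x hx, hpos x hx]
    rcases hs with hs | ⟨hs, hd⟩
    · exact H.finished x hx (hs ▸ hx')
    · by_cases hxs : x = s
      · rw [hxs, hd]
      · refine H.finished x hx fun hmem => ?_
        rcases List.mem_cons.1 hmem with hm | hm
        · exact hxs hm
        · exact hx' (hs ▸ hm)
  · intro x hx
    rw [ho] at hx
    rw [hn x hx, hpos x hx]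
    exact H.nxt_le x hx
  · intro x hx p hp
    rw [ho] at hx ⊢
    rw [hn x hx] at hp
    rw [hpos x hx]
    have hy : ∀ v, (∃ y ∈ c.owned i, (c y).pos = v) → ∃ y ∈ c.owned i, (c' y).pos = v := by
      rintro v ⟨y, hy, rfl⟩
      exact ⟨y, hy, hpos y hy⟩
    rcases H.explored x hx p hp with h1 | ⟨h1, h2⟩ | ⟨h1, h2⟩
    · exact Or.inl (hy _ h1)
    · exact Or.inr (Or.inl ⟨h1, fun h3 => h2 (hocc h1 _ h3)⟩)
    · rw [h2]
      rcases hb h1 with h3 | ⟨h3, h4⟩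
      · exact Or.inl (hy _ h3)
      · exact Or.inr (Or.inl ⟨h3, fun h5 => h4 (hocc h3 _ h5)⟩)
  · intro x hx
    rw [ho] at hx ⊢
    obtain ⟨n, h1, h2⟩ := H.tree x hx
    exact ⟨n, h1, h2.keep hk hx⟩
  · simp only [weight, ho]
    rw [Finset.sum_congr rfl hn]

/-- The invariant after a round in which the group becomes the owner of the probed node. -/
theorem SearchInv.of_extend (H : SearchInv d L c i s rest h true e) (hk : Keeps i c c')
    (hz : z ∉ c.owned i) (ho : c'.owned i = insert z (c.owned i))
    (hn : ∀ x ∈ c.owned i, c'.nxt x = c.nxt x)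
    (hzp : (c' z).pos = h) (hzn : c'.nxt z = 0) (hzpar : c'.par z = some e)
    (hocc : d = false → ∀ v, c'.Occ v → c.Occ v)
    (hm : ∃ r, c'.Mover i r)
    (hh : ∀ r, c'.Mover i r → (c' r).pos = h ∧ (c' r).mem.probe = false) :
    SearchInv d L c' i z (s :: rest) h false 0 ∧ c'.weight i = c.weight i + 1 := by
  have hpos : ∀ x ∈ c.owned i, (c' x).pos = (c x).pos := fun x hx => (hk x hx).2.1
  have hi : i ∈ c.owned i := by
    have := H.stack_owned _ (List.getLast_mem (l := s :: rest) (by simp))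
    rwa [H.last] at this
  have hs : s ∈ c.owned i := H.stack_owned s (by simp)
  obtain ⟨-, hes⟩ := H.at_probe rfl
  refine ⟨{ mover := hm
            head := fun r hr => ⟨(hh r hr).1, (hh r hr).2, by simp⟩
            stack_owned := ?_
            nodup := List.nodup_cons.2 ⟨fun hmem => hz (H.stack_owned z hmem), H.nodup⟩
            chain := ?_, last := ?_, root := ?_, finished := ?_, nxt_le := ?_
            explored := ?_
            at_top := fun _ => hzp.symm
            at_probe := by simp, tree := ?_ }, ?_⟩
  · intro x hx
    rw [ho]
    rcases List.mem_cons.1 hx with rfl | hx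
    · exact Finset.mem_insert_self _ _
    · exact Finset.mem_insert_of_mem (H.stack_owned x hx)
  · rw [List.isChain_cons_cons]
    exact ⟨⟨e, hzpar, by rw [hzp, hes, hpos s hs]⟩, chain_keep hk H.stack_owned H.chain⟩
  · rw [List.getLast_cons (by simp), H.last]
  · rw [(hk i hi).2.2, H.root]
  · intro x hx hx'
    rw [ho] at hx
    rcases Finset.mem_insert.1 hx with rfl | hx
    · exact absurd (List.mem_cons_self) hx'
    · rw [hn x hx, hpos x hx]
      exact H.finished x hx fun hmem => hx' (List.mem_cons_of_mem _ hmem)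
  · intro x hx
    rw [ho] at hx
    rcases Finset.mem_insert.1 hx with rfl | hx
    · rw [hzn]; exact Nat.zero_le _
    · rw [hn x hx, hpos x hx]
      exact H.nxt_le x hx
  · intro x hx p hp
    rw [ho] at hx
    rcases Finset.mem_insert.1 hx with rfl | hx
    · rw [hzn] at hp; exact absurd hp (Nat.not_lt_zero _)
    · rw [hn x hx] at hp
      rw [hpos x hx, ho]
      rcases H.explored x hx p hp with ⟨y, hy, h1⟩ | ⟨h1, h2⟩ | ⟨-, h2⟩
      · exact Or.inl ⟨y, Finset.mem_insert_of_mem hy, (hpos y hy).trans h1⟩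
      · exact Or.inr (Or.inl ⟨h1, fun h3 => h2 (hocc h1 _ h3)⟩)
      · exact Or.inl ⟨z, Finset.mem_insert_self _ _, hzp.trans h2.symm⟩
  · intro x hx
    rw [ho] at hx ⊢
    rw [Finset.card_insert_of_notMem hz]
    rcases Finset.mem_insert.1 hx with rfl | hx
    · obtain ⟨n, h1, h2⟩ := H.tree s hs
      exact ⟨n + 1, by omega, e, s, hzpar, (hk s hs).1, by rw [hpos s hs, hzp, hes], h2.keep hk hs⟩
    · obtain ⟨n, h1, h2⟩ := H.tree x hx
      exact ⟨n, by omega, h2.keep hk hx⟩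
  · simp only [weight, ho]
    rw [Finset.sum_insert hz, Finset.card_insert_of_notMem hz, hzn, Finset.sum_congr rfl hn]
    ring

/-- The invariant after a round in which the group leaves through an unexplored port. -/
theorem SearchInv.of_probe (H : SearchInv d L c i s rest h false e) (hk : Keeps i c c')
    (ho : c'.owned i = c.owned i) (hlt : c.nxt s < G.degree h)
    (hns : c'.nxt s = c.nxt s + 1)
    (hn : ∀ x ∈ c.owned i, x ≠ s → c'.nxt x = c.nxt x)
    (hocc : d = false → ∀ v, c'.Occ v → c.Occ v)
    (hm : ∃ r, c'.Mover i r)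
    (hh : ∀ r, c'.Mover i r → (c' r).pos = L.tgt h (c.nxt s) ∧ (c' r).mem.probe = true ∧
      (c' r).entry = L.ent h (c.nxt s)) :
    SearchInv d L c' i s rest (L.tgt h (c.nxt s)) true (L.ent h (c.nxt s)) ∧
      c'.weight i = c.weight i + 2 := by
  have hpos : ∀ x ∈ c.owned i, (c' x).pos = (c x).pos := fun x hx => (hk x hx).2.1
  have hi : i ∈ c.owned i := by
    have := H.stack_owned _ (List.getLast_mem (l := s :: rest) (by simp))
    rwa [H.last] at this
  have hs : s ∈ c.owned i := H.stack_owned s (by simp)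
  have hhs : h = (c s).pos := H.at_top rfl
  refine ⟨{ mover := hm
            head := fun r hr => ⟨(hh r hr).1, (hh r hr).2.1, fun _ => (hh r hr).2.2⟩
            stack_owned := fun x hx => ho ▸ H.stack_owned x hx
            nodup := H.nodup
            chain := chain_keep hk H.stack_owned H.chain
            last := H.last
            root := ?_, finished := ?_, nxt_le := ?_
            explored := ?_
            at_top := by simp
            at_probe := fun _ => ⟨L.ent_lt hlt, by rw [L.tgt_ent hlt, hpos s hs, hhs]⟩
            tree := ?_ }, ?_⟩
  · rw [(hk i hi).2.2, H.root]
  · intro x hx hx'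
    rw [ho] at hx
    have hxs : x ≠ s := fun h => hx' (h ▸ List.mem_cons_self)
    rw [hn x hx hxs, hpos x hx]
    exact H.finished x hx hx'
  · intro x hx
    rw [ho] at hx
    rw [hpos x hx]
    by_cases hxs : x = s
    · subst hxs; rw [hns, ← hhs]; exact hlt
    · rw [hn x hx hxs]; exact H.nxt_le x hx
  · intro x hx p hp
    rw [ho] at hx ⊢
    rw [hpos x hx]
    have hold : p < c.nxt x → (∃ y ∈ c.owned i, (c' y).pos = L.tgt (c x).pos p) ∨
        (d = false ∧ ¬ c'.Occ (L.tgt (c x).pos p)) := by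
      intro hp
      rcases H.explored x hx p hp with ⟨y, hy, h1⟩ | ⟨h1, h2⟩ | ⟨h1, -⟩
      · exact Or.inl ⟨y, hy, (hpos y hy).trans h1⟩
      · exact Or.inr ⟨h1, fun h3 => h2 (hocc h1 _ h3)⟩
      · simp at h1
    by_cases hxs : x = s
    · subst hxs
      rw [hns] at hp
      rcases Nat.lt_succ_iff_lt_or_eq.1 hp with hp | hp
      · rcases hold hp with h1 | h1
        exacts [Or.inl h1, Or.inr (Or.inl h1)]
      · exact Or.inr (Or.inr ⟨rfl, by rw [hp, hhs]⟩)
    · rw [hn x hx hxs] at hp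
      rcases hold hp with h1 | h1
      exacts [Or.inl h1, Or.inr (Or.inl h1)]
  · intro x hx
    rw [ho] at hx ⊢
    obtain ⟨n, h1, h2⟩ := H.tree x hx
    exact ⟨n, h1, h2.keep hk hx⟩
  · simp only [weight, ho]
    rw [← Finset.add_sum_erase _ _ hs, ← Finset.add_sum_erase (a := s) _ (fun x => c.nxt x) hs, hns,
      Finset.sum_congr rfl (g := fun x => c.nxt x)]
    · ring
    · intro x hx
      rw [Finset.mem_erase] at hx
      exact hn x hx.2 hx.1

end Conf

namespace Conf

variable {V : Type*} [Fintype V] [DecidableEq V] {G : SimpleGraph V} [DecidableRel G.Adj]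
  {k Δ : ℕ} {c : Conf V k Δ} {L : PortLabelling G} {d : Bool} {i s z : Fin k}
  {rest : List (Fin k)} {h : V} {b : Bool} {e t : ℕ}

open ClockedRule

theorem not_dominated (hu : c.Undominated d i) {r : Fin k} (hl : c.lab r = i.succ)
    (ho : d = true ∨ c.Occ (c r).pos) : ¬ c.Dominated r := by
  rintro ⟨r', h1, h2⟩
  exact absurd (hu r r' hl h1 ho) (not_le.2 (hl ▸ h2))

theorem keeps_search (hu : c.Undominated d i) : Keeps i c (search d L c) := by
  intro x hx
  obtain ⟨hs, hl⟩ := mem_owned.1 hx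
  refine ⟨mem_owned.2 ⟨settled_search hs, ?_⟩, pos_search_settled hs, ?_⟩
  all_goals
    rcases search_settled_cases (d := d) (L := L) hs with ⟨r₀, -, h1, h2, -⟩ | ⟨-, h1, h2, -⟩
    · exact absurd ⟨r₀, h1, h2⟩ (not_dominated hu hl (Or.inr ⟨x, hs, rfl⟩))
    · first | exact h1.trans hl | exact h2

theorem nxt_search_of_probe (hu : c.Undominated d i) (hΔ : ∀ v, G.degree v ≤ Δ) {x : Fin k}
    (hx : x ∈ c.owned i) (hm : ∃ r, c.Mover i r ∧ (c r).pos = (c x).pos ∧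
      (c r).mem.probe = false) (hlt : c.nxt x < G.degree (c x).pos) :
    (search d L c).nxt x = c.nxt x + 1 := by
  obtain ⟨hs, hl⟩ := mem_owned.1 hx
  rcases search_settled_cases (d := d) (L := L) hs with ⟨r₀, -, h1, h2, -⟩ | ⟨-, -, -, h1, -⟩
  · exact absurd ⟨r₀, h1, h2⟩ (not_dominated hu hl (Or.inr ⟨x, hs, rfl⟩))
  · obtain ⟨r, ⟨h2, h3⟩, h4, h5⟩ := hm
    rw [nxt, h1 ⟨⟨r, h2, h4, h3.trans hl.symm, h5⟩, hlt⟩]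
    have := hΔ (c x).pos
    simp only [Fin.ofNat]
    exact Nat.mod_eq_of_lt (by omega)

theorem nxt_search_of_not (hu : c.Undominated d i) {x : Fin k}
    (hx : x ∈ c.owned i) (hm : ¬ ((∃ r, c.Mover i r ∧ (c r).pos = (c x).pos ∧
      (c r).mem.probe = false) ∧ c.nxt x < G.degree (c x).pos)) :
    (search d L c).nxt x = c.nxt x := by
  obtain ⟨hs, hl⟩ := mem_owned.1 hx
  rcases search_settled_cases (d := d) (L := L) hs with ⟨r₀, -, h1, h2, -⟩ | ⟨-, -, -, -, h1⟩
  · exact absurd ⟨r₀, h1, h2⟩ (not_dominated hu hl (Or.inr ⟨x, hs, rfl⟩))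
  · refine h1 fun ⟨⟨r, h2, h3, h4, h5⟩, h6⟩ => hm ⟨⟨r, ⟨h2, h4.trans hl⟩, h3, h5⟩, h6⟩

/-- A node that becomes owned by group `i` holds a mover of the group; either the settled robot of
the node changes the owner, or a mover settles at an empty node. -/
theorem owned_search_gain (hc : c.Distinct) {x : Fin k} (hx : x ∈ (search d L c).owned i)
    (hx' : x ∉ c.owned i) :
    (c.Settled x ∧ ∃ r, c.Mover i r ∧ (c r).pos = (c x).pos) ∨
    (d = true ∧ c.Mover i x ∧ ¬ c.Occ (c x).pos ∧
      ∀ r', (c r').pos = (c x).pos → c.lab r' = c.lab x → r' ≤ x) := by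
  obtain ⟨h1, h2⟩ := mem_owned.1 hx
  by_cases hs : c.Settled x
  · left
    refine ⟨hs, ?_⟩
    rcases search_settled_cases (d := d) (L := L) hs with ⟨r₀, h3, h4, -, -, h5⟩ | ⟨-, h3, -⟩
    · rw [lab, h5] at h2
      exact ⟨r₀, ⟨h3, h2⟩, h4⟩
    · exact absurd (mem_owned.2 ⟨hs, h3.symm.trans h2⟩) hx'
  · right
    obtain ⟨h3, h4, -, h5, -⟩ := settle_cases hc hs h1
    rw [lab_search_mover hc hs] at h2
    exact ⟨h3, ⟨hs, h2⟩, h4, h5⟩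

theorem mover_of_search (hc : c.Distinct) {r : Fin k} (hr : (search d L c).Mover i r) :
    c.Mover i r := by
  have hs : ¬ c.Settled r := fun h => hr.1 (settled_search h)
  exact ⟨hs, (lab_search_mover hc hs).symm.trans hr.2⟩

theorem mover_search_of_occ (hc : c.Distinct) {r : Fin k} (hr : c.Mover i r)
    (ho : c.Occ (c r).pos) : (search d L c).Mover i r := by
  obtain ⟨h1, h2, -⟩ := search_mover_occ_cases (d := d) (L := L) hc hr.1 ho
  exact ⟨h1, h2.trans hr.2⟩

theorem owned_search_eq (hc : c.Distinct) (hu : c.Undominated d i)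
    (hg : ∀ x r, c.Mover i r → (c r).pos = (c x).pos → c.Settled x → x ∈ c.owned i)
    (ho : d = true → ∀ r, c.Mover i r → c.Occ (c r).pos) :
    (search d L c).owned i = c.owned i := by
  ext x
  refine ⟨fun hx => ?_, fun hx => (keeps_search hu x hx).1⟩
  by_contra hx'
  rcases owned_search_gain hc hx hx' with ⟨h1, r, h2, h3⟩ | ⟨h1, h2, h3, -⟩
  · exact hx' (hg x r h2 h3 h1)
  · exact h3 (ho h1 x h2)

/-- Group `i` is searching, and it has worked in each of `t` rounds: the measure of progress grows
by one per round, up to the contribution of the stack and of the probe flag. -/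
def Searching (d : Bool) (L : PortLabelling G) (c : Conf V k Δ) (i : Fin k) (t : ℕ) : Prop :=
  ∃ s rest h b e, SearchInv d L c i s rest h b e ∧
    c.weight i = t + (rest.length + 1) + if b = true then 1 else 0

/-- Group `i` has completed its search: it is at the root, and has explored all ports there. -/
def Complete (d : Bool) (L : PortLabelling G) (c : Conf V k Δ) (i : Fin k) : Prop :=
  ∃ s h e, SearchInv d L c i s [] h false e ∧ c.nxt s = G.degree (c s).pos

section Round

variable (hc : c.Distinct) (hu : c.Undominated d i) (hΔ : ∀ v, G.degree v ≤ Δ)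

include hc in
theorem occ_of_search : d = false → ∀ v, (search d L c).Occ v → c.Occ v := by
  rintro rfl v hv
  exact (occ_search_gather hc).1 hv

include hc hu in
/-- A group that does not probe is at an owned node, which its movers leave as the settled robot
there tells. -/
theorem SearchInv.not_probing (H : SearchInv d L c i s rest h false e) :
    (search d L c).owned i = c.owned i ∧ (∃ r, (search d L c).Mover i r) ∧
      ∀ r, (search d L c).Mover i r → search d L c r = move L h
        (if c.nxt s < G.degree h then ({ (c r).mem with probe := true }, some (c.nxt s))
        else ((c r).mem, c.par s)) := by
  classical
  have hh : h = (c s).pos := H.at_top rfl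
  obtain ⟨hss, hsl⟩ := mem_owned.1 (H.stack_owned s (by simp))
  have hocc : ∀ r, c.Mover i r → c.Occ (c r).pos := fun r hr =>
    ⟨s, hss, by rw [(H.head r hr).1, hh]⟩
  refine ⟨owned_search_eq hc hu ?_ fun _ => hocc, ?_, ?_⟩
  · intro x r hr hp hx
    have : x = s := hc x s hx hss (by rw [← hp, (H.head r hr).1, hh])
    rw [this]
    exact H.stack_owned s (by simp)
  · obtain ⟨r, hr⟩ := H.mover
    exact ⟨r, mover_search_of_occ hc hr (hocc r hr)⟩
  · intro r hr'
    have hr := mover_of_search hc hr'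
    obtain ⟨h1, h2, -⟩ := H.head r hr
    rw [search_mover_occ hc hr.1 hss (by rw [h1, hh]),
      if_neg (not_dominated hu hr.2 (Or.inr (hocc r hr))), h2, h1]
    simp

include hc hu hΔ in
theorem SearchInv.probe_step (H : SearchInv d L c i s rest h false e)
    (hlt : c.nxt s < G.degree h) :
    SearchInv d L (search d L c) i s rest (L.tgt h (c.nxt s)) true (L.ent h (c.nxt s)) ∧
      (search d L c).weight i = c.weight i + 2 := by
  have hh : h = (c s).pos := H.at_top rfl
  have hs := H.stack_owned s (by simp)
  obtain ⟨h1, h2, h3⟩ := H.not_probing hc hu (L := L)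
  refine H.of_probe (keeps_search hu) h1 hlt ?_ ?_ (occ_of_search hc) h2 ?_
  · obtain ⟨r, hr⟩ := H.mover
    exact nxt_search_of_probe hu hΔ hs ⟨r, hr, by rw [(H.head r hr).1, hh], (H.head r hr).2.1⟩
      (hh ▸ hlt)
  · intro x hx hxs
    refine nxt_search_of_not hu hx fun ⟨⟨r, hr, hp, _⟩, _⟩ => hxs ?_
    exact hc x s (mem_owned.1 hx).1 (mem_owned.1 hs).1 (by rw [← hp, (H.head r hr).1, hh])
  · intro r hr
    rw [h3 r hr, if_pos hlt]
    exact ⟨rfl, rfl, rfl⟩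

include hc hu in
theorem SearchInv.backtrack_step (H : SearchInv d L c i s rest h false e)
    (hge : ¬ c.nxt s < G.degree h) {s' : Fin k} {rest' : List (Fin k)}
    (hrest : rest = s' :: rest' ∨ rest = [] ∧ s' = s ∧ rest' = []) :
    SearchInv d L (search d L c) i s' rest' (c s').pos false 0 ∧
      (search d L c).weight i = c.weight i ∧ (search d L c).nxt s = c.nxt s := by
  have hh : h = (c s).pos := H.at_top rfl
  have hs := H.stack_owned s (by simp)
  have hdeg : c.nxt s = G.degree (c s).pos := le_antisymm (H.nxt_le s hs) (by rw [← hh]; omega)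
  obtain ⟨h1, h2, h3⟩ := H.not_probing hc hu (L := L)
  have hn : ∀ x ∈ c.owned i, (search d L c).nxt x = c.nxt x := by
    intro x hx
    refine nxt_search_of_not hu hx fun ⟨⟨r, hr, hp, _⟩, hlt⟩ => ?_
    have : x = s :=
      hc x s (mem_owned.1 hx).1 (mem_owned.1 hs).1 (by rw [← hp, (H.head r hr).1, hh])
    subst this
    exact hge (hh ▸ hlt)
  rw [← and_assoc]
  refine ⟨H.of_return (keeps_search hu) h1 hn (occ_of_search hc) ?_ h2 ?_ (by simp), hn s hs⟩
  · rcases hrest with h4 | ⟨h4, h5, h6⟩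
    · exact Or.inr ⟨h4.symm, hdeg⟩
    · left; rw [h4, h5, h6]
  · intro r hr
    have hprobe := (H.head r (mover_of_search hc hr)).2.1
    rw [h3 r hr, if_neg hge]
    rcases hrest with rfl | ⟨rfl, rfl, rfl⟩
    · have hch := H.chain
      rw [List.isChain_cons_cons] at hch
      obtain ⟨⟨p, hp1, hp2⟩, -⟩ := hch
      rw [hp1]
      exact ⟨by rw [← hp2, hh]; rfl, hprobe⟩
    · have hsi : s' = i := by simpa using H.last
      rw [hsi, H.root, ← hsi]
      exact ⟨hh, hprobe⟩

include hu in
theorem SearchInv.nxt_probing (H : SearchInv d L c i s rest h true e) :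
    ∀ x ∈ c.owned i, (search d L c).nxt x = c.nxt x := by
  intro x hx
  refine nxt_search_of_not hu hx fun ⟨⟨r, hr, _, hp⟩, _⟩ => ?_
  rw [(H.head r hr).2.1] at hp
  exact absurd hp (by simp)

include hc hu hΔ in
/-- A probed node that is occupied is left at once if it is owned by the group; otherwise it
becomes owned by the group. -/
theorem SearchInv.occupied_step (H : SearchInv d L c i s rest h true e) (hocc : c.Occ h) :
    (SearchInv d L (search d L c) i s rest (c s).pos false 0 ∧
      (search d L c).weight i = c.weight i) ∨
    ∃ z, SearchInv d L (search d L c) i z (s :: rest) h false 0 ∧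
      (search d L c).weight i = c.weight i + 1 := by
  classical
  obtain ⟨z, hz, hzh⟩ := hocc
  obtain ⟨hedeg, hes⟩ := H.at_probe rfl
  obtain ⟨m, hm⟩ := H.mover
  have hocc : ∀ r, c.Mover i r → c.Occ (c r).pos := fun r hr =>
    ⟨z, hz, by rw [(H.head r hr).1, hzh]⟩
  have hzm : (c z).pos = (c m).pos := by rw [(H.head m hm).1, hzh]
  have hle : c.lab z ≤ i.succ := hu m z hm.2 hzm (Or.inr (hocc m hm))
  have hex : ∃ r, (search d L c).Mover i r := ⟨m, mover_search_of_occ hc hm (hocc m hm)⟩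
  have hstep : ∀ r, (search d L c).Mover i r → search d L c r = move L h
      ({ (c r).mem with probe := false }, if c.lab z = i.succ then some e else none) := by
    intro r hr'
    have hr := mover_of_search hc hr'
    obtain ⟨h1, h2, h3⟩ := H.head r hr
    rw [search_mover_occ hc hr.1 hz (by rw [h1, hzh]),
      if_neg (not_dominated hu hr.2 (Or.inr (hocc r hr))), h2, h1, h3 rfl, hr.2]
    simp
  have hzx : ∀ x r, c.Mover i r → (c r).pos = (c x).pos → c.Settled x → x = z := by
    intro x r hr hp hx
    exact hc x z hx hz (by rw [← hp, (H.head r hr).1, hzh])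
  by_cases hown : z ∈ c.owned i
  · left
    have hlz := (mem_owned.1 hown).2
    refine H.of_return (keeps_search hu) (owned_search_eq hc hu ?_ fun _ => hocc)
      (H.nxt_probing hu) (occ_of_search hc) (Or.inl rfl) hex ?_ fun _ => Or.inl ⟨z, hown, hzh⟩
    · intro x r hr hp hx
      rw [hzx x r hr hp hx]
      exact hown
    · intro r hr
      rw [hstep r hr, if_pos hlz]
      exact ⟨hes, rfl⟩
  · right
    have hlt : c.lab z < i.succ := lt_of_le_of_ne hle fun h => hown (mem_owned.2 ⟨hz, h⟩)
    have hzmem : (search d L c z).mem = ⟨true, i.succ, some (Fin.ofNat _ e), 0, false⟩ := by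
      rcases search_settled_cases (d := d) (L := L) hz with
        ⟨r₀, h1, h2, -, h4, h5⟩ | ⟨h1, -⟩
      · have hlr : c.lab r₀ = i.succ := by
          apply le_antisymm
          · exact hu m r₀ hm.2 (h2.trans hzm) (Or.inr (hocc m hm))
          · rw [← hm.2]; exact h4 m hm.1 hzm.symm
        rw [h5, hlr, (H.head r₀ ⟨h1, hlr⟩).2.2 rfl]
      · have := h1 m hm.1 hzm.symm
        rw [hm.2] at this
        exact absurd hlt (not_lt.2 this)
    refine ⟨z, H.of_extend (keeps_search hu) hown ?_ (H.nxt_probing hu) ?_ ?_ ?_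
      (occ_of_search hc) hex ?_⟩
    · ext x
      rw [Finset.mem_insert]
      constructor
      · intro hx
        by_contra! hcon
        rcases owned_search_gain hc hx hcon.2 with ⟨h1, r, h2, h3⟩ | ⟨-, h2, h3, -⟩
        · exact hcon.1 (hzx x r h2 h3 h1)
        · exact h3 (hocc x h2)
      · rintro (rfl | hx)
        · exact mem_owned.2 ⟨settled_search hz, by rw [lab, hzmem]⟩
        · exact (keeps_search hu x hx).1
    · rw [pos_search_settled hz, hzh]
    · rw [nxt, hzmem]; rfl
    · have := hΔ h
      rw [par, hzmem]
      simp only [Option.map_some, Fin.ofNat]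
      rw [Nat.mod_eq_of_lt (by omega)]
    · intro r hr
      rw [hstep r hr, if_neg (ne_of_lt hlt)]
      exact ⟨rfl, rfl⟩

include hc hu hΔ in
/-- A probed node that is empty is left at once if the search does not disperse; otherwise a mover
settles there, and the search ends if it was the last mover of the group. -/
theorem SearchInv.empty_step (H : SearchInv d L c i s rest h true e) (hocc : ¬ c.Occ h) :
    (¬ ∃ r, (search d L c).Mover i r) ∨
    (SearchInv d L (search d L c) i s rest (c s).pos false 0 ∧
      (search d L c).weight i = c.weight i) ∨
    ∃ z, SearchInv d L (search d L c) i z (s :: rest) h false 0 ∧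
      (search d L c).weight i = c.weight i + 1 := by
  classical
  obtain ⟨hedeg, hes⟩ := H.at_probe rfl
  obtain ⟨m, hm⟩ := H.mover
  have hnocc : ∀ r, c.Mover i r → ¬ c.Occ (c r).pos := fun r hr => by
    rwa [(H.head r hr).1]
  cases d with
  | false =>
    right; left
    have hstep : ∀ r, c.Mover i r → search false L c r = move L h
        ({ (c r).mem with probe := false }, some e) := by
      intro r hr
      obtain ⟨h1, h2, h3⟩ := H.head r hr
      rw [search_mover_gather hr.1 (hnocc r hr), h1, h3 rfl]
    refine H.of_return (keeps_search hu) (owned_search_eq hc hu ?_ (by simp))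
      (H.nxt_probing hu) (occ_of_search hc) (Or.inl rfl) ⟨m, ?_⟩ ?_ fun _ => Or.inr ⟨rfl, hocc⟩
    · intro x r hr hp hx
      exact absurd ⟨x, hx, hp.symm⟩ (hnocc r hr)
    · unfold Mover Settled lab
      rw [hstep m hm]
      exact hm
    · intro r hr
      rw [hstep r (mover_of_search hc hr)]
      exact ⟨hes, rfl⟩
  | true =>
    by_cases hex : ∃ r, (search true L c).Mover i r
    swap
    · exact Or.inl hex
    right; right
    -- the mover with the largest identifier settles
    obtain ⟨z, hz, hmax⟩ := Finset.exists_max_image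
      (Finset.univ.filter fun r => c.Mover i r) id ⟨m, by simpa using hm⟩
    simp only [Finset.mem_filter, Finset.mem_univ, true_and, id] at hz hmax
    have hlab : ∀ r, (c r).pos = h → c.lab r = i.succ → c.Mover i r := fun r hp hl =>
      ⟨fun hs => hocc ⟨r, hs, hp⟩, hl⟩
    obtain ⟨hz1, -, hz3⟩ := H.head z hz
    have hstep : search true L c z =
        ⟨h, ⟨true, i.succ, some (Fin.ofNat _ e), 0, false⟩, 0⟩ := by
      rw [search_mover_disperse hz.1 (hnocc z hz), if_neg (not_dominated hu hz.2 (Or.inl rfl)),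
        if_neg, hz.2, hz1, hz3 rfl]
      rintro ⟨r', h1, h2, h3⟩
      exact absurd h3 (not_lt.2 (hmax r' (hlab r' (h1.trans hz1) (h2.trans hz.2))))
    refine ⟨z, H.of_extend (keeps_search hu) (fun h => hz.1 (mem_owned.1 h).1) ?_
      (H.nxt_probing hu) ?_ ?_ ?_ (occ_of_search hc) hex ?_⟩
    · ext x
      rw [Finset.mem_insert]
      constructor
      · intro hx
        by_contra! hcon
        rcases owned_search_gain hc hx hcon.2 with ⟨h1, r, h2, h3⟩ | ⟨-, h2, h3, h4⟩
        · exact hnocc r h2 ⟨x, h1, h3.symm⟩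
        · exact hcon.1 (le_antisymm (hmax x h2)
            (h4 z (by rw [hz1, (H.head x h2).1]) (hz.2.trans h2.2.symm)))
      · rintro (rfl | hx)
        · exact mem_owned.2 ⟨by rw [Settled, hstep], by rw [lab, hstep]⟩
        · exact (keeps_search hu x hx).1
    · rw [hstep]
    · rw [nxt, hstep]; rfl
    · have := hΔ h
      rw [par, hstep]
      simp only [Option.map_some, Fin.ofNat]
      rw [Nat.mod_eq_of_lt (by omega)]
    · intro r hr
      have hr0 := mover_of_search hc hr
      have hx := search_mover_disperse (L := L) hr0.1 (hnocc r hr0)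
      rw [if_neg (not_dominated hu hr0.2 (Or.inl rfl)), (H.head r hr0).1] at hx
      split_ifs at hx
      · rw [hx]; exact ⟨rfl, rfl⟩
      · exact absurd (by rw [Settled, hx]) hr.1

include hc hu hΔ in
theorem Searching.step (H : Searching d L c i t) :
    (¬ ∃ r, (search d L c).Mover i r) ∨ Complete d L (search d L c) i ∨
      Searching d L (search d L c) i (t + 1) := by
  obtain ⟨s, rest, h, b, e, H, hw⟩ := H
  cases b with
  | false =>
    rw [if_neg (by simp)] at hw
    by_cases hlt : c.nxt s < G.degree h
    · obtain ⟨h1, h2⟩ := H.probe_step hc hu hΔ hlt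
      exact Or.inr (Or.inr ⟨_, _, _, _, _, h1, by rw [h2, hw, if_pos rfl]; ring⟩)
    · cases rest with
      | nil =>
        obtain ⟨h1, -, h3⟩ := H.backtrack_step hc hu hlt (Or.inr ⟨rfl, rfl, rfl⟩)
        have hs := H.stack_owned s (by simp)
        refine Or.inr (Or.inl ⟨_, _, _, h1, ?_⟩)
        rw [h3, pos_search_settled (mem_owned.1 hs).1]
        exact le_antisymm (H.nxt_le s hs) (by rw [← H.at_top rfl]; omega)
      | cons s' rest' =>
        obtain ⟨h1, h2, -⟩ := H.backtrack_step hc hu hlt (Or.inl rfl)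
        refine Or.inr (Or.inr ⟨_, _, _, _, _, h1, ?_⟩)
        rw [h2, hw, if_neg (by simp), List.length_cons]
        ring
  | true =>
    rw [if_pos rfl] at hw
    have key : ((SearchInv d L (search d L c) i s rest (c s).pos false 0 ∧
        (search d L c).weight i = c.weight i) ∨
      ∃ z, SearchInv d L (search d L c) i z (s :: rest) h false 0 ∧
        (search d L c).weight i = c.weight i + 1) → Searching d L (search d L c) i (t + 1) := by
      rintro (⟨h1, h2⟩ | ⟨z, h1, h2⟩)
      · exact ⟨_, _, _, _, _, h1, by rw [h2, hw, if_neg (by simp)]; ring⟩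
      · exact ⟨_, _, _, _, _, h1, by rw [h2, hw, if_neg (by simp), List.length_cons]; ring⟩
    by_cases hocc : c.Occ h
    · exact Or.inr (Or.inr (key (H.occupied_step hc hu hΔ hocc)))
    · rcases H.empty_step hc hu hΔ hocc with h1 | h1
      · exact Or.inl h1
      · exact Or.inr (Or.inr (key h1))

include hc hu in
theorem Complete.step (H : Complete d L c i) : Complete d L (search d L c) i := by
  obtain ⟨s, h, e, H, hd⟩ := H
  have hlt : ¬ c.nxt s < G.degree h := by rw [H.at_top rfl, hd]; simp
  obtain ⟨h1, -, h3⟩ := H.backtrack_step hc hu hlt (Or.inr ⟨rfl, rfl, rfl⟩)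
  have hs := H.stack_owned s (by simp)
  exact ⟨_, _, _, h1, by rw [h3, hd, pos_search_settled (mem_owned.1 hs).1]⟩

end Round

end Conf

namespace Conf

variable {V : Type*} [Fintype V] [DecidableEq V] {G : SimpleGraph V} [DecidableRel G.Adj]
  {k Δ : ℕ} {c : Conf V k Δ} {L : PortLabelling G} {d : Bool} {i : Fin k} {t T : ℕ}

open ClockedRule

/-! ### A whole search -/

/-- The configuration after `t` rounds of a search that starts from the positions of `c`. -/
noncomputable def searchRun (d : Bool) (L : PortLabelling G) (c : Conf V k Δ) (t : ℕ) :
    Conf V k Δ :=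
  (search d L)^[t] c.found

theorem searchRun_succ (d : Bool) (L : PortLabelling G) (c : Conf V k Δ) (t : ℕ) :
    searchRun d L c (t + 1) = search d L (searchRun d L c t) :=
  Function.iterate_succ_apply' _ _ _

theorem distinct_searchRun (d : Bool) (L : PortLabelling G) (c : Conf V k Δ) (t : ℕ) :
    (searchRun d L c t).Distinct := by
  induction t with
  | zero => exact distinct_found c
  | succ t ih => rw [searchRun_succ]; exact distinct_search ih

theorem tied_searchRun (d : Bool) (L : PortLabelling G) (c : Conf V k Δ) (t : ℕ) :
    (searchRun d L c t).Tied G L (fun j => (c j).pos) (fun j => c.found.lab j = j.succ) := by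
  induction t with
  | zero => exact tied_found L c
  | succ t ih => rw [searchRun_succ]; exact tied_search (distinct_searchRun d L c t) ih

theorem exists_lab_searchRun {r : Fin k} (hr : ¬ (searchRun d L c t).Settled r) :
    ∃ j : Fin k, (searchRun d L c t).lab r = j.succ := by
  induction t with
  | zero => exact exists_lab_found hr
  | succ t ih =>
    rw [searchRun_succ] at hr ⊢
    have hr' : ¬ (searchRun d L c t).Settled r := fun h => hr (settled_search h)
    rw [lab_search_mover (distinct_searchRun d L c t) hr']
    exact ih hr'

theorem occ_searchRun_mono {v : V} {t' : ℕ} (ht : t ≤ t') (h : (searchRun d L c t).Occ v) :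
    (searchRun d L c t').Occ v := by
  induction t', ht using Nat.le_induction with
  | base => exact h
  | succ t' _ ih => rw [searchRun_succ]; exact occ_search ih

theorem occ_searchRun_gather {v : V} :
    (searchRun false L c t).Occ v ↔ ∃ r, (c r).pos = v := by
  induction t with
  | zero => exact occ_found
  | succ t ih =>
    rw [searchRun_succ, occ_search_gather (distinct_searchRun false L c t), ih]

theorem mover_searchRun_gather {r : Fin k} (h : c.found.Mover i r) :
    (searchRun false L c t).Mover i r := by
  induction t with
  | zero => exact h
  | succ t ih =>
    have hd := distinct_searchRun false L c t
    rw [searchRun_succ]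
    refine ⟨fun hs => ?_, (lab_search_mover hd ih.1).trans ih.2⟩
    exact absurd (settle_cases hd ih.1 hs).1 (by simp)

theorem searching_found (L : PortLabelling G) (h : c.found.lab i = i.succ) :
    Searching d L c.found i 0 := by
  obtain ⟨h1, -, -, m, h3, h4, h5⟩ := lab_found_eq_succ h
  have hown : c.found.owned i = {i} := by
    ext x
    rw [mem_owned, Finset.mem_singleton]
    constructor
    · rintro ⟨hx1, hx2⟩
      exact (distinct_found c) x i hx1 h1 (lab_found_eq_succ hx2).2.1.symm
    · rintro rfl; exact ⟨h1, h⟩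
  have hnxt : ∀ x, c.found.nxt x = 0 := fun x => rfl
  refine ⟨i, [], (c i).pos, false, 0, ⟨⟨m, h3, h5⟩, ?_, ?_, by simp, .singleton _, rfl, rfl, ?_, ?_,
    ?_, fun _ => rfl, by simp, ?_⟩, ?_⟩
  · intro r hr
    exact ⟨(lab_found_eq_succ hr.2).2.1.symm, rfl, by simp⟩
  · simp [hown]
  · simp [hown]
  · simp [hnxt]
  · simp [hnxt]
  · intro x hx
    rw [hown, Finset.mem_singleton] at hx
    subst hx
    exact ⟨0, by simp [hown], rfl⟩
  · simp [weight, hown, hnxt]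

/-- A group whose label is the largest in its component, in the sense of a set `S` that contains
all nodes occupied during the search, meets no larger label. -/
theorem undominated_searchRun {S : V → Prop}
    (hS : ∀ t' ≤ T, ∀ v, (searchRun d L c t').Occ v → S v)
    (hmax : ∀ j, c.found.lab j = j.succ → Linked G S (c i).pos (c j).pos → j ≤ i)
    (ht : t < T) : (searchRun d L c t).Undominated d i := by
  intro r r' hr hp ho
  by_contra! hlt
  obtain ⟨j, hj⟩ : ∃ j : Fin k, j.succ = (searchRun d L c t).lab r' := by
    rw [Fin.exists_succ_eq]
    rintro h0
    rw [h0] at hlt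
    exact absurd hlt (by simp)
  rw [← hj, Fin.succ_lt_succ_iff] at hlt
  have hT := tied_searchRun d L c t
  have hd := distinct_searchRun d L c t
  by_cases hocc : (searchRun d L c t).Occ (searchRun d L c t r).pos
  · obtain ⟨-, h1, -⟩ := hT r i hr
    obtain ⟨hR, h2, -⟩ := hT r' j hj.symm
    rw [hp] at h2
    exact absurd (hmax j hR (((h1 hocc).trans (h2 hocc).symm).mono (hS t ht.le))) (not_le.2 hlt)
  · -- in a dispersing search, the common node is occupied one round later
    obtain rfl : d = true := ho.resolve_right hocc
    have hu : ¬ (searchRun true L c t).Settled r := fun h => hocc ⟨r, h, rfl⟩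
    have hu' : ¬ (searchRun true L c t).Settled r' := fun h => hocc ⟨r', h, hp⟩
    have ho' := occ_search_disperse (L := L) (c := searchRun true L c t) r
    rw [← searchRun_succ] at ho'
    have hT := tied_searchRun true L c (t + 1)
    obtain ⟨-, h1, -⟩ := hT r i (by rw [searchRun_succ, lab_search_mover hd hu, hr])
    obtain ⟨hR, h2, -⟩ := hT r' j (by rw [searchRun_succ, lab_search_mover hd hu', hj])
    rw [searchRun_succ, pos_search_empty_disperse hu hocc, ← searchRun_succ] at h1
    rw [searchRun_succ, pos_search_empty_disperse hu' (by rwa [hp]), ← searchRun_succ, hp] at h2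
    exact absurd (hmax j hR (((h1 ho').trans (h2 ho').symm).mono (hS (t + 1) ht)))
      (not_le.2 hlt)

/-- `T` rounds suffice for the search of a group: the measure of progress of a group that owns the
nodes of the robots in `O` never exceeds the left-hand side. -/
def Suffices (G : SimpleGraph V) [DecidableRel G.Adj] (k T : ℕ) : Prop :=
  ∀ (O : Finset (Fin k)) (p : Fin k → V), Set.InjOn p O →
    2 * ∑ x ∈ O, G.degree (p x) + O.card ≤ T

theorem Searching.lt (hc : c.Distinct) (H : Searching d L c i t) (hT : Suffices G k T) :
    t < T := by
  obtain ⟨s, rest, h, b, e, H, hw⟩ := H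
  have h1 := hT (c.owned i) (fun r => (c r).pos) fun r hr s hs h =>
    hc r s (mem_owned.1 hr).1 (mem_owned.1 hs).1 h
  have h2 : c.weight i ≤ 2 * ∑ x ∈ c.owned i, G.degree (c x).pos + (c.owned i).card := by
    have := Finset.sum_le_sum H.nxt_le
    unfold weight
    omega
  omega

/-- A group that meets no larger label settles completely or completes its search. -/
theorem searchRun_end (hΔ : ∀ v, G.degree v ≤ Δ) (hT : Suffices G k T)
    (hi : c.found.lab i = i.succ)
    (hu : ∀ t < T, (searchRun d L c t).Undominated d i) :
    (¬ ∃ r, (searchRun d L c T).Mover i r) ∨ Complete d L (searchRun d L c T) i := by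
  have key : ∀ t ≤ T, (¬ ∃ r, (searchRun d L c t).Mover i r) ∨
      Complete d L (searchRun d L c t) i ∨ Searching d L (searchRun d L c t) i t := by
    intro t
    induction t with
    | zero => exact fun _ => Or.inr (Or.inr (searching_found L hi))
    | succ t ih =>
      intro ht
      have hd := distinct_searchRun d L c t
      have hut := hu t (by omega)
      rw [searchRun_succ]
      rcases ih (by omega) with h | h | h
      · exact Or.inl fun ⟨r, hr⟩ => h ⟨r, mover_of_search hd hr⟩
      · exact Or.inr (Or.inl (h.step hd hut))
      · exact h.step hd hut hΔ
  rcases key T le_rfl with h | h | h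
  · exact Or.inl h
  · exact Or.inr h
  · exact absurd (h.lt (distinct_searchRun d L c T) hT) (lt_irrefl _)

/-- After a complete search, every explored direction leads to an owned node or, if the search
does not disperse, to an empty node. -/
theorem Complete.neighbor (H : Complete d L c i) {x : Fin k} (hx : x ∈ c.owned i) {w : V}
    (hw : G.Adj (c x).pos w) : (∃ y ∈ c.owned i, (c y).pos = w) ∨ d = false ∧ ¬ c.Occ w := by
  obtain ⟨s, h, e, H, hd⟩ := H
  obtain ⟨p, hp, rfl⟩ := L.exists_port hw
  have : c.nxt x = G.degree (c x).pos := by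
    by_cases hxs : x = s
    · rw [hxs, hd]
    · exact H.finished x hx (by simpa using hxs)
  rcases H.explored x hx p (by omega) with h1 | h1 | h1
  · exact Or.inl h1
  · exact Or.inr h1
  · simp at h1

theorem Complete.root_mem (H : Complete d L c i) : i ∈ c.owned i := by
  obtain ⟨s, h, e, H, -⟩ := H
  have : s = i := by simpa using H.last
  exact this ▸ H.stack_owned s (by simp)

/-- In the component of a robot there is a group with the largest label. -/
theorem exists_max_group {S : V → Prop} {v : V} {j : Fin k} (hj : c.found.lab j = j.succ)
    (hv : Linked G S (c j).pos v) :
    ∃ i, c.found.lab i = i.succ ∧ Linked G S (c i).pos v ∧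
      ∀ j', c.found.lab j' = j'.succ → Linked G S (c i).pos (c j').pos → j' ≤ i := by
  classical
  obtain ⟨i, hi, hmax⟩ := Finset.exists_max_image
    (Finset.univ.filter fun j' => c.found.lab j' = Fin.succ j' ∧ Linked G S (c j').pos v) id
    ⟨j, by simp [hj, hv]⟩
  simp only [Finset.mem_filter, Finset.mem_univ, true_and, id] at hi hmax
  exact ⟨i, hi.1, hi.2, fun j' hj' hl => hmax j' ⟨hj', hl.symm.trans hi.2⟩⟩

/-! ### Multiply occupied nodes -/

/-- Node `v` holds at least two of the robots placed by `p`. -/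
def Multi (p : Fin k → V) (v : V) : Prop := ∃ r r', r ≠ r' ∧ p r = v ∧ p r' = v

theorem multi_of_lab_found (h : c.found.lab i = i.succ) :
    Multi (fun r => (c r).pos) (c i).pos := by
  obtain ⟨h1, -, -, r, h2, h3, -⟩ := lab_found_eq_succ h
  exact ⟨i, r, fun hir => h2 (hir ▸ h1), rfl, h3⟩

theorem pos_ne_of_lab_found {j : Fin k} (hi : c.found.lab i = i.succ)
    (hj : c.found.lab j = j.succ) (hij : i ≠ j) : (c i).pos ≠ (c j).pos := fun h =>
  hij (distinct_found c i j (lab_found_eq_succ hi).1 (lab_found_eq_succ hj).1 h)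

/-- After a dispersing search, a node with two robots lies in a component, with respect to the
nodes with robots, that contains two of the nodes that had several robots before. The reason is
that the group with the largest label in the component has settled completely: otherwise it would
have explored the whole graph, and there would be more robots than nodes. -/
theorem multi_disperse (hG : G.Connected) (hk : k ≤ Fintype.card V) (hΔ : ∀ v, G.degree v ≤ Δ)
    (hT : Suffices G k T) {v : V}
    (hv : Multi (fun r => (searchRun true L c T r).pos) v) :
    ∃ a b, a ≠ b ∧ Multi (fun r => (c r).pos) a ∧ Multi (fun r => (c r).pos) b ∧
      Linked G (fun w => ∃ r, (searchRun true L c T r).pos = w) v a ∧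
      Linked G (fun w => ∃ r, (searchRun true L c T r).pos = w) v b := by
  set c' := searchRun true L c T with hc'
  have hd : c'.Distinct := distinct_searchRun true L c T
  obtain ⟨r, hr, hrv⟩ : ∃ r, ¬ c'.Settled r ∧ (c' r).pos = v := by
    obtain ⟨r, r', hne, hr, hr'⟩ := hv
    by_cases hs : c'.Settled r
    · exact ⟨r', fun hs' => hne (hd r r' hs hs' (hr.trans hr'.symm)), hr'⟩
    · exact ⟨r, hs, hr⟩
  obtain ⟨j, hj⟩ := exists_lab_searchRun hr
  have hocc : ∀ w, c'.Occ w → ∃ r, (c' r).pos = w := fun w ⟨s, _, hs⟩ => ⟨s, hs⟩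
  obtain ⟨hR, h1, h2⟩ := tied_searchRun true L c T r j hj
  have hjv : Linked G (fun w => ∃ r, (c' r).pos = w) (c j).pos v := by
    by_cases ho : c'.Occ (c' r).pos
    · rw [← hrv]; exact (h1 ho).mono hocc
    · obtain ⟨h3, h4, h5⟩ := h2 ho
      rw [← hrv]
      exact (h5.mono hocc).trans (Linked.single (L.adj_tgt h3).symm (hocc _ h4) ⟨r, rfl⟩)
  obtain ⟨i, hi, hiv, hmax⟩ := exists_max_group hR hjv
  have hend := searchRun_end (L := L) (d := true) hΔ hT hi fun t ht =>
    undominated_searchRun (fun t' ht' w hw => hocc w (occ_searchRun_mono ht' hw)) hmax ht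
  have hij : i ≠ j := by
    rintro rfl
    rcases hend with h | h
    · exact h ⟨r, hr, hj⟩
    · have hall : ∀ w, ∃ x ∈ c'.owned i, (c' x).pos = w := by
        intro w
        obtain ⟨wk⟩ := hG.preconnected (c' i).pos w
        have : ∀ {u w : V} (q : G.Walk u w), (∃ x ∈ c'.owned i, (c' x).pos = u) →
            ∃ x ∈ c'.owned i, (c' x).pos = w := by
          intro u w q
          induction q with
          | nil => exact id
          | cons hadj _ ih =>
            rintro ⟨x, hx, rfl⟩
            refine ih ?_
            rcases h.neighbor hx hadj with h1 | ⟨h1, -⟩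
            · exact h1
            · simp at h1
        exact this wk ⟨i, h.root_mem, rfl⟩
      have hcard : Fintype.card V ≤ (c'.owned i).card := by
        rw [← Finset.card_univ]
        calc (Finset.univ : Finset V).card
            ≤ ((c'.owned i).image fun x => (c' x).pos).card := by
              refine Finset.card_le_card fun w _ => ?_
              rw [Finset.mem_image]
              exact hall w
          _ ≤ _ := Finset.card_image_le
      have hlt : (c'.owned i).card < k := by
        have := Finset.card_lt_univ_of_notMem (s := c'.owned i) (x := r)
          fun h => hr (mem_owned.1 h).1
        simpa using this
      omega
  exact ⟨(c i).pos, (c j).pos, pos_ne_of_lab_found hi hR hij, multi_of_lab_found hi,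
    multi_of_lab_found hR, hiv.symm, hjv.symm⟩

/-! ### The walk to the roots -/

theorem mem_walk (c : Conf V k Δ) (r : Fin k) : (walk L c r).mem = (c r).mem := by
  have key : ∀ (v : V) (o : Option ℕ), (move L v ((c r).mem, o)).mem = (c r).mem := by
    intro v o; cases o <;> rfl
  unfold walk walkRule
  simp only [view_self]
  split_ifs
  all_goals exact key _ _

theorem pos_walk_settled {r : Fin k} (hr : c.Settled r) : (walk L c r).pos = (c r).pos := by
  have hr' : (c r).mem.settled = true := hr
  simp only [walk, walkRule, view_self, hr', if_true, move]

theorem settled_walk {r : Fin k} : (walk L c).Settled r ↔ c.Settled r := by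
  rw [Settled, Settled, mem_walk c]

theorem walk_mover_occ (hc : c.Distinct) {r z : Fin k} (hr : ¬ c.Settled r) (hz : c.Settled z)
    (hp : (c z).pos = (c r).pos) : walk L c r = move L (c r).pos ((c r).mem, c.par z) := by
  have hr' : ¬ (c r).mem.settled = true := hr
  have h : ∃ q : Memo k Δ × ℕ, (∃ s, view c (c r).pos s = some q) ∧ q.1.settled = true :=
    (exists_settled_iff _).2 ⟨z, hz, hp⟩
  obtain ⟨⟨s, hs⟩, hq⟩ := h.choose_spec
  rw [view_eq_some] at hs
  obtain ⟨h1, h2⟩ := hs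
  rw [← h2] at hq
  have hsz : s = z := hc s z hq hz (h1.trans hp.symm)
  subst hsz
  simp only [walk, walkRule, view_self, hr', if_false, Bool.false_eq_true]
  rw [dif_pos h, ← h2]
  rfl

theorem walk_mover_empty {r : Fin k} (hr : ¬ c.Settled r) (ho : ¬ c.Occ (c r).pos) :
    walk L c r = move L (c r).pos ((c r).mem, some (c r).entry) := by
  have hr' : ¬ (c r).mem.settled = true := hr
  simp only [walk, walkRule, view_self, hr', if_false, Bool.false_eq_true]
  rw [dif_neg (by rwa [exists_settled_iff])]

theorem distinct_walk (hc : c.Distinct) : (walk L c).Distinct := by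
  intro r s hr hs hp
  rw [settled_walk] at hr hs
  rw [pos_walk_settled hr, pos_walk_settled hs] at hp
  exact hc r s hr hs hp

theorem keeps_walk : Keeps i c (walk L c) := by
  intro x hx
  have hs := (mem_owned.1 hx).1
  refine ⟨?_, pos_walk_settled hs, by rw [par, mem_walk c]; rfl⟩
  rw [mem_owned, settled_walk, lab, mem_walk c]
  exact mem_owned.1 hx

/-- A mover that starts at a node from which the stored ports lead to the root of group `i` is at
the root after as many rounds, and stays there. -/
theorem pos_walk_iterate (hc : c.Distinct) (hi : i ∈ c.owned i) (hroot : c.par i = none)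
    {n u : ℕ} (hnu : n ≤ u) {r z : Fin k} (hr : ¬ c.Settled r) (hz : z ∈ c.owned i)
    (hp : (c z).pos = (c r).pos) (hpath : ParentPath L c i n z i) :
    ((walk L)^[u] c r).pos = (c i).pos := by
  induction u generalizing c n z with
  | zero =>
    obtain rfl : n = 0 := by omega
    rw [show z = i from hpath] at hp
    exact hp.symm
  | succ u ih =>
    have hk := keeps_walk (L := L) (i := i) (c := c)
    obtain ⟨hi1, hi2, hi3⟩ := hk i hi
    have hstep := walk_mover_occ (L := L) hc hr (mem_owned.1 hz).1 hp
    rw [Function.iterate_succ_apply, ← hi2]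
    cases n with
    | zero =>
      obtain rfl : z = i := hpath
      refine ih (distinct_walk hc) hi1 (hi3.trans hroot) (Nat.zero_le u)
        (by rwa [settled_walk]) hi1 ?_ rfl
      rw [hi2, hstep, hroot]
      exact hp
    | succ n =>
      obtain ⟨q, y, h1, h2, h3, h4⟩ := hpath
      refine ih (distinct_walk hc) hi1 (hi3.trans hroot) (Nat.succ_le_succ_iff.1 hnu)
        (by rwa [settled_walk]) (hk y h2).1 ?_ (h4.keep hk h2)
      rw [(hk y h2).2.1, hstep, h1, h3, hp]
      rfl

theorem settled_walk_iterate (c : Conf V k Δ) (u : ℕ) (r : Fin k) :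
    ((walk L)^[u] c).Settled r ↔ c.Settled r := by
  induction u generalizing c with
  | zero => rfl
  | succ u ih => rw [Function.iterate_succ_apply, ih, settled_walk]

theorem distinct_walk_iterate (hc : c.Distinct) (u : ℕ) : ((walk L)^[u] c).Distinct := by
  induction u generalizing c with
  | zero => exact hc
  | succ u ih => rw [Function.iterate_succ_apply]; exact ih (distinct_walk hc)

/-- After a search that does not disperse and a walk to the roots, a node with two robots is the
root of the group with the largest label in its component, so that there is at most one such node
in each component with respect to the nodes with robots. -/
theorem multi_gather (hΔ : ∀ v, G.degree v ≤ Δ) (hT : Suffices G k T) (hkT : k < T) {v : V}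
    (hv : Multi (fun r => ((walk L)^[T] (searchRun false L c T) r).pos) v) :
    ∃ i, v = (c i).pos ∧ c.found.lab i = i.succ ∧ ∀ j, c.found.lab j = j.succ →
      Linked G (fun w => ∃ r, (c r).pos = w) (c i).pos (c j).pos → j ≤ i := by
  set c' := searchRun false L c T with hc'
  have hd : c'.Distinct := distinct_searchRun false L c T
  have hd' := distinct_walk_iterate (L := L) hd T
  obtain ⟨r, hr, hrv⟩ : ∃ r, ¬ c'.Settled r ∧ ((walk L)^[T] c' r).pos = v := by
    obtain ⟨r, r', hne, hr, hr'⟩ := hv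
    simp only [← settled_walk_iterate (L := L) c' T]
    by_cases hs : ((walk L)^[T] c').Settled r
    · exact ⟨r', fun hs' => hne (hd' r r' hs hs' (hr.trans hr'.symm)), hr'⟩
    · exact ⟨r, hs, hr⟩
  obtain ⟨j, hj⟩ := exists_lab_searchRun hr
  have hocc : ∀ w, c'.Occ w → ∃ r, (c r).pos = w := fun w => occ_searchRun_gather.1
  obtain ⟨hR, h1, h2⟩ := tied_searchRun false L c T r j hj
  -- the node `u` from which the walk along the stored ports starts
  obtain ⟨u, hju, huo⟩ : ∃ u, Linked G (fun w => ∃ r, (c r).pos = w) (c j).pos u ∧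
      ((u = (c' r).pos ∧ c'.Occ (c' r).pos) ∨
        (u = L.tgt (c' r).pos (c' r).entry ∧ ¬ c'.Occ (c' r).pos)) := by
    by_cases ho : c'.Occ (c' r).pos
    · exact ⟨_, (h1 ho).mono hocc, Or.inl ⟨rfl, ho⟩⟩
    · obtain ⟨h3, h4, h5⟩ := h2 ho
      exact ⟨_, h5.mono hocc, Or.inr ⟨rfl, ho⟩⟩
  obtain ⟨i, hi, hiu, hmax⟩ := exists_max_group hR hju
  refine ⟨i, ?_, hi, hmax⟩
  have hcomp : Complete false L c' i := by
    refine (searchRun_end (L := L) (d := false) hΔ hT hi fun t ht =>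
      undominated_searchRun (fun t' _ w hw => occ_searchRun_gather.1 hw) hmax ht).resolve_left ?_
    obtain ⟨-, -, -, m, h3, -, h4⟩ := lab_found_eq_succ hi
    exact fun h => h ⟨m, mover_searchRun_gather ⟨h3, h4⟩⟩
  have hio := hcomp.root_mem
  have his : c.found.Settled i := (lab_found_eq_succ hi).1
  have hipos : (c' i).pos = (c i).pos := by
    have : ∀ t, (searchRun false L c t).Settled i ∧ (searchRun false L c t i).pos = (c i).pos := by
      intro t
      induction t with
      | zero => exact ⟨his, rfl⟩
      | succ t ih =>
        rw [searchRun_succ]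
        exact ⟨settled_search ih.1, (pos_search_settled ih.1).trans ih.2⟩
    exact (this T).2
  have hcover : ∀ w, Linked G (fun w => ∃ r, (c r).pos = w) (c i).pos w →
      ∃ x ∈ c'.owned i, (c' x).pos = w := by
    intro w hw
    induction hw with
    | refl => exact ⟨i, hio, hipos⟩
    | tail _ hab ih =>
      obtain ⟨x, hx, rfl⟩ := ih
      rcases hcomp.neighbor hx hab.1 with h3 | ⟨-, h3⟩
      · exact h3
      · exact absurd (occ_searchRun_gather.2 hab.2.2) h3
  obtain ⟨z, hz, hzu⟩ := hcover u hiu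
  obtain ⟨s, h, e, H, -⟩ := hcomp
  obtain ⟨n, hn, hpath⟩ := H.tree z hz
  have hnk : n < k := lt_of_lt_of_le hn (by simpa using Finset.card_le_univ (c'.owned i))
  rw [← hrv, ← hipos]
  rcases huo with ⟨h3, -⟩ | ⟨h3, h4⟩
  · exact pos_walk_iterate hd hio H.root (by omega) hr hz (hzu.trans h3) hpath
  · obtain ⟨T, rfl⟩ : ∃ T', T = T' + 1 := ⟨T - 1, by omega⟩
    have hk := keeps_walk (L := L) (i := i) (c := c')
    rw [Function.iterate_succ_apply, ← (hk i hio).2.1]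
    refine pos_walk_iterate (distinct_walk hd) (hk i hio).1 ((hk i hio).2.2.trans H.root)
      (show n ≤ T by omega) (by rwa [settled_walk]) (hk z hz).1 ?_ (hpath.keep hk hz)
    rw [(hk z hz).2.1, hzu, h3, walk_mover_empty hr h4]
    rfl

end Conf

/-! ### Phases -/

namespace Conf

variable {V : Type*} [Fintype V] [DecidableEq V] {G : SimpleGraph V} [DecidableRel G.Adj]
  {k Δ : ℕ} {c : Conf V k Δ} {L : PortLabelling G} {T : ℕ}

open ClockedRule

/-- The configuration after a phase: a dispersing search, a search that does not disperse, and a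
walk to the roots. -/
noncomputable def phase (L : PortLabelling G) (T : ℕ) (c : Conf V k Δ) : Conf V k Δ :=
  (walk L)^[T] (searchRun false L (searchRun true L c T) T)

open Classical in
/-- The nodes with at least two robots. -/
noncomputable def multiNodes (c : Conf V k Δ) : Finset V :=
  Finset.univ.filter (Multi fun r => (c r).pos)

theorem mem_multiNodes {v : V} : v ∈ c.multiNodes ↔ Multi (fun r => (c r).pos) v := by
  simp [multiNodes]

theorem card_multiNodes_le (c : Conf V k Δ) : c.multiNodes.card ≤ k := by
  calc c.multiNodes.card ≤ (Finset.univ.image fun r => (c r).pos).card := by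
        refine Finset.card_le_card fun v hv => ?_
        obtain ⟨r, -, -, hr, -⟩ := mem_multiNodes.1 hv
        exact Finset.mem_image.2 ⟨r, Finset.mem_univ _, hr⟩
    _ ≤ k := by simpa using Finset.card_image_le (s := (Finset.univ : Finset (Fin k)))
                  (f := fun r => (c r).pos)

theorem pos_injective_of_multiNodes (h : c.multiNodes.card = 0) :
    Function.Injective fun r => (c r).pos := by
  intro r r' hrr
  by_contra hne
  have : (c r').pos ∈ c.multiNodes := mem_multiNodes.2 ⟨r, r', hne, hrr, rfl⟩
  rw [Finset.card_eq_zero.1 h] at this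
  simp at this

/-- A phase halves the number of nodes with at least two robots: the ones that remain lie in
different components (after the dispersing search), and each of these components contains two of
the old ones. -/
theorem two_mul_card_multiNodes_phase (hG : G.Connected) (hk : k ≤ Fintype.card V)
    (hΔ : ∀ v, G.degree v ≤ Δ) (hT : Suffices G k T) (hkT : k < T) :
    2 * (phase L T c).multiNodes.card ≤ c.multiNodes.card := by
  classical
  set c₁ := searchRun true L c T with hc₁
  set S : V → Prop := fun w => ∃ r, (c₁ r).pos = w with hS
  have hroot : ∀ v ∈ (phase L T c).multiNodes, ∃ i, v = (c₁ i).pos ∧ c₁.found.lab i = i.succ ∧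
      ∀ j, c₁.found.lab j = j.succ → Linked G S (c₁ i).pos (c₁ j).pos → j ≤ i := fun v hv =>
    multi_gather hΔ hT hkT (mem_multiNodes.1 hv)
  have hsep : ∀ v ∈ (phase L T c).multiNodes, ∀ w ∈ (phase L T c).multiNodes,
      Linked G S v w → v = w := by
    intro v hv w hw hvw
    obtain ⟨i, rfl, hi, himax⟩ := hroot v hv
    obtain ⟨j, rfl, hj, hjmax⟩ := hroot w hw
    rw [le_antisymm (hjmax i hi hvw.symm) (himax j hj hvw)]
  have htwo : ∀ v ∈ (phase L T c).multiNodes,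
      2 ≤ (c.multiNodes.filter fun u => Linked G S v u).card := by
    intro v hv
    obtain ⟨i, rfl, hi, -⟩ := hroot v hv
    obtain ⟨a, b, hab, ha, hb, hva, hvb⟩ :=
      multi_disperse (L := L) (c := c) hG hk hΔ hT (multi_of_lab_found hi)
    refine Finset.one_lt_card.2 ⟨a, ?_, b, ?_, hab⟩
    · exact Finset.mem_filter.2 ⟨mem_multiNodes.2 ha, hva⟩
    · exact Finset.mem_filter.2 ⟨mem_multiNodes.2 hb, hvb⟩
  calc 2 * (phase L T c).multiNodes.card
      = ∑ _v ∈ (phase L T c).multiNodes, 2 := by simp [mul_comm]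
    _ ≤ ∑ v ∈ (phase L T c).multiNodes, (c.multiNodes.filter fun u => Linked G S v u).card :=
        Finset.sum_le_sum htwo
    _ = ((phase L T c).multiNodes.biUnion fun v =>
          c.multiNodes.filter fun u => Linked G S v u).card := by
        rw [Finset.card_biUnion]
        intro v hv w hw hvw
        rw [Function.onFun, Finset.disjoint_left]
        intro u hu hu'
        exact hvw (hsep v hv w hw
          ((Finset.mem_filter.1 hu).2.trans (Finset.mem_filter.1 hu').2.symm))
    _ ≤ c.multiNodes.card :=
        Finset.card_le_card (Finset.biUnion_subset.2 fun v _ => Finset.filter_subset _ _)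

end Conf

/-- The rule of the algorithm. A phase lasts `3 * T + 2` rounds. -/
noncomputable def dispersionRule (k Δ T : ℕ) : ClockedRule k (Memo k Δ) :=
  fun t self δ w =>
    if t % (3 * T + 2) = 0 ∨ t % (3 * T + 2) = T + 1 then (foundRule self w, none)
    else if t % (3 * T + 2) ≤ T then searchRule true self δ w
    else if t % (3 * T + 2) ≤ 2 * T + 1 then searchRule false self δ w
    else walkRule self w

namespace ClockedRule

variable {V : Type*} [Fintype V] [DecidableEq V] {G : SimpleGraph V} [DecidableRel G.Adj]
  {k Δ : ℕ} {L : PortLabelling G} {T : ℕ}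

theorem run_add_eq_iterate {M : Type*} {F : ClockedRule k M} {m₀ : M} {start : Fin k → V}
    {f : (Fin k → Robot V M) → Fin k → Robot V M} {a n : ℕ}
    (h : ∀ t, a ≤ t → t < a + n → ∀ c, F.step L t c = f c) :
    F.run L m₀ start (a + n) = f^[n] (F.run L m₀ start a) := by
  induction n with
  | zero => rfl
  | succ n ih =>
    rw [Function.iterate_succ_apply', ← ih fun t h1 h2 => h t h1 (by omega)]
    exact h (a + n) (by omega) (by omega) _

theorem run_phase (m₀ : Memo k Δ) (start : Fin k → V) (q : ℕ) :
    (dispersionRule k Δ T).run L m₀ start ((3 * T + 2) * (q + 1)) =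
      Conf.phase L T ((dispersionRule k Δ T).run L m₀ start ((3 * T + 2) * q)) := by
  set F := dispersionRule k Δ T with hF
  set a := (3 * T + 2) * q with ha
  have hmod : ∀ s, s < 3 * T + 2 → (a + s) % (3 * T + 2) = s := fun s hs => by
    rw [ha, Nat.mul_add_mod, Nat.mod_eq_of_lt hs]
  have hfound : ∀ t, (t % (3 * T + 2) = 0 ∨ t % (3 * T + 2) = T + 1) → ∀ c : Conf V k Δ,
      F.step L t c = c.found := by
    intro t ht c
    funext r
    simp only [hF, step, dispersionRule, if_pos ht]
    rfl
  have h1 := run_add_eq_iterate (F := F) (L := L) (m₀ := m₀) (start := start) (a := a) (n := 1)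
    (f := Conf.found) fun t h1 h2 c => hfound t (by
      obtain rfl : t = a + 0 := by omega
      rw [hmod 0 (by omega)]; simp) c
  have h2 := run_add_eq_iterate (F := F) (L := L) (m₀ := m₀) (start := start) (a := a + 1)
    (n := T) (f := Conf.search true L) fun t h1 h2 c => by
      obtain ⟨s, rfl⟩ := Nat.exists_eq_add_of_le (show a ≤ t by omega)
      funext r
      simp only [hF, step, dispersionRule, hmod s (by omega)]
      rw [if_neg (by omega), if_pos (by omega)]
      rfl
  have h3 := run_add_eq_iterate (F := F) (L := L) (m₀ := m₀) (start := start) (a := a + 1 + T)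
    (n := 1) (f := Conf.found) fun t h1 h2 c => hfound t (by
      obtain rfl : t = a + (T + 1) := by omega
      rw [hmod (T + 1) (by omega)]; simp) c
  have h4 := run_add_eq_iterate (F := F) (L := L) (m₀ := m₀) (start := start)
    (a := a + 1 + T + 1) (n := T) (f := Conf.search false L) fun t h1 h2 c => by
      obtain ⟨s, rfl⟩ := Nat.exists_eq_add_of_le (show a ≤ t by omega)
      funext r
      simp only [hF, step, dispersionRule, hmod s (by omega)]
      rw [if_neg (by omega), if_neg (by omega), if_pos (by omega)]
      rfl
  have h5 := run_add_eq_iterate (F := F) (L := L) (m₀ := m₀) (start := start)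
    (a := a + 1 + T + 1 + T) (n := T) (f := Conf.walk L) fun t h1 h2 c => by
      obtain ⟨s, rfl⟩ := Nat.exists_eq_add_of_le (show a ≤ t by omega)
      funext r
      simp only [hF, step, dispersionRule, hmod s (by omega)]
      rw [if_neg (by omega), if_neg (by omega), if_neg (by omega)]
      rfl
  rw [show (3 * T + 2) * (q + 1) = a + 1 + T + 1 + T + T by rw [ha]; ring, h5, h4, h3, h2, h1]
  rfl

/-- After `q` phases the robots are on distinct nodes if `k < 2 ^ q`. -/
theorem pos_injective_run (hG : G.Connected) (hk : k ≤ Fintype.card V)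
    (hΔ : ∀ v, G.degree v ≤ Δ) (hT : Conf.Suffices G k T) (hkT : k < T) (m₀ : Memo k Δ)
    (start : Fin k → V) {q : ℕ} (hq : k < 2 ^ q) :
    Function.Injective fun r =>
      ((dispersionRule k Δ T).run L m₀ start ((3 * T + 2) * q) r).pos := by
  have key : ∀ q, 2 ^ q * Finset.card (Conf.multiNodes
      ((dispersionRule k Δ T).run L m₀ start ((3 * T + 2) * q))) ≤ k := by
    intro q
    induction q with
    | zero => simpa using Conf.card_multiNodes_le _
    | succ q ih =>
      rw [run_phase, pow_succ, mul_assoc]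
      exact (Nat.mul_le_mul_left _ (Conf.two_mul_card_multiNodes_phase hG hk hΔ hT hkT)).trans ih
  refine Conf.pos_injective_of_multiNodes ?_
  by_contra h0
  have := (Nat.le_mul_of_pos_right (2 ^ q) (Nat.pos_of_ne_zero h0)).trans (key q)
  omega

end ClockedRule

/-! ### The algorithm and its cost -/

/-- The program that never moves. -/
def RobotProgram.idle (k : ℕ) : RobotProgram k where
  memBits := 0
  initMem := fun _ => false
  compute := fun _ _ _ => ⟨fun _ => none, none⟩

/-- The length of a search: it exceeds the largest measure of progress of a group, and the largest
number of robots. -/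
def searchLength (m Δ k : ℕ) : ℕ := 8 * min m (k * Δ)

/-- The number of rounds of the algorithm: `⌊log₂ k⌋ + 1` phases. -/
def totalRounds (m Δ k : ℕ) : ℕ := (3 * searchLength m Δ k + 2) * (Nat.log 2 k + 1)

/-- The number of values that the memory and the clock of a robot take. -/
def memoCard (m Δ k : ℕ) : ℕ :=
  2 * ((k + 1) * ((Δ + 1 + 1) * ((Δ + 1) * 2))) * (totalRounds m Δ k + 1)

theorem exists_coding (m Δ k : ℕ) :
    Nonempty (Memo k Δ × Fin (totalRounds m Δ k + 1) ↪
      (Fin (Nat.clog 2 (memoCard m Δ k)) → Bool)) := by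
  have h1 : Nonempty ((Bool × Fin (k + 1) × Option (Fin (Δ + 1)) × Fin (Δ + 1) × Bool) ×
      Fin (totalRounds m Δ k + 1) ↪ (Fin (Nat.clog 2 (memoCard m Δ k)) → Bool)) := by
    refine Function.Embedding.nonempty_of_card_le ?_
    simp only [Fintype.card_prod, Fintype.card_bool, Fintype.card_fin, Fintype.card_option,
      Fintype.card_fun]
    exact Nat.le_pow_clog one_lt_two _
  obtain ⟨f⟩ := h1
  refine ⟨⟨fun x => f ((x.1.settled, x.1.label, x.1.parent, x.1.next, x.1.probe), x.2), ?_⟩⟩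
  rintro ⟨⟨a1, a2, a3, a4, a5⟩, a6⟩ ⟨⟨b1, b2, b3, b4, b5⟩, b6⟩ h
  have := f.injective h
  simp only [Prod.mk.injEq] at this
  obtain ⟨⟨rfl, rfl, rfl, rfl, rfl⟩, rfl⟩ := this
  rfl

/-- The algorithm. With at most one robot there is nothing to do, and the bounds leave no choice:
`log₂ k = 0` allows no round, and on a graph with one node `log₂ n = 0` allows no memory. -/
noncomputable def dispersionAlgorithm : DispersionAlgorithm := fun _ m Δ k =>
  if k ≤ 1 then RobotProgram.idle k
  else (dispersionRule k Δ (searchLength m Δ k)).toProgram (exists_coding m Δ k).some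

section Cost

variable {V : Type*} [Fintype V] [DecidableEq V] {G : SimpleGraph V} [DecidableRel G.Adj]
  {k : ℕ}

theorem RobotProgram.pos_run_idle (L : PortLabelling G) (start : Fin k → V) (t : ℕ) :
    ((RobotProgram.idle k).run L start t).pos = start := by
  induction t with
  | zero => rfl
  | succ t ih =>
    rw [RobotProgram.run, Function.iterate_succ_apply']
    exact ih

theorem min_bounds (hG : G.Connected) (hk : k ≤ Fintype.card V) (hk2 : 2 ≤ k) :
    1 ≤ min G.edgeFinset.card (k * G.maxDegree) ∧
      k ≤ 2 * min G.edgeFinset.card (k * G.maxDegree) := by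
  have hm : Fintype.card V ≤ G.edgeFinset.card + 1 := by
    have := hG.card_vert_le_card_edgeSet_add_one
    rwa [Nat.card_eq_fintype_card, Nat.card_eq_fintype_card, ← SimpleGraph.edgeFinset_card]
      at this
  have : Nontrivial V := Fintype.one_lt_card_iff_nontrivial.1 (by omega)
  have hΔ : 1 ≤ G.maxDegree := by
    obtain ⟨v⟩ := hG.nonempty
    exact (hG.preconnected.degree_pos_of_nontrivial v).trans_le (G.degree_le_maxDegree v)
  have h1 : k ≤ k * G.maxDegree := Nat.le_mul_of_pos_right k hΔ
  constructor
  · exact le_min (by omega) (by omega)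
  · rcases min_choice G.edgeFinset.card (k * G.maxDegree) with h | h <;> rw [h] <;> omega

theorem suffices_searchLength (hG : G.Connected) (hk : k ≤ Fintype.card V) (hk2 : 2 ≤ k) :
    Conf.Suffices G k (searchLength G.edgeFinset.card G.maxDegree k) := by
  intro O p hp
  obtain ⟨-, h2⟩ := min_bounds hG hk hk2
  have hcard : O.card ≤ k := by simpa using Finset.card_le_univ O
  have hs1 : ∑ x ∈ O, G.degree (p x) ≤ 2 * G.edgeFinset.card := by
    rw [← G.sum_degrees_eq_twice_card_edges, ← Finset.sum_image (f := fun v => G.degree v) hp]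
    exact Finset.sum_le_sum_of_subset (Finset.subset_univ _)
  have hs2 : ∑ x ∈ O, G.degree (p x) ≤ k * G.maxDegree :=
    calc ∑ x ∈ O, G.degree (p x) ≤ O.card • G.maxDegree :=
          Finset.sum_le_card_nsmul _ _ _ fun x _ => G.degree_le_maxDegree _
      _ ≤ k * G.maxDegree := Nat.mul_le_mul_right _ hcard
  unfold searchLength
  rcases min_choice G.edgeFinset.card (k * G.maxDegree) with h | h <;> rw [h] at h2 ⊢ <;> omega

theorem memoCard_le {n m Δ : ℕ} (hn : 2 ≤ n) (hk : k ≤ n) (hΔ : Δ + 1 ≤ n) :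
    memoCard m Δ k ≤ n ^ 15 := by
  have hlog : Nat.log 2 k + 1 ≤ n := by
    rcases Nat.eq_zero_or_pos k with rfl | h
    · simp; omega
    · have := Nat.log_lt_self 2 h.ne'
      omega
  have hsearch : searchLength m Δ k ≤ 8 * n ^ 2 := by
    unfold searchLength
    have : min m (k * Δ) ≤ n ^ 2 := (min_le_right _ _).trans (by
      rw [sq]; exact Nat.mul_le_mul hk (by omega))
    omega
  have hn2 : 4 ≤ n ^ 2 := by nlinarith
  have hn5 : 32 ≤ n ^ 5 := by
    calc 32 = 2 ^ 5 := by norm_num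
      _ ≤ n ^ 5 := Nat.pow_le_pow_left hn 5
  have htotal : totalRounds m Δ k + 1 ≤ n ^ 8 := by
    calc totalRounds m Δ k + 1 ≤ (25 * n ^ 2) * n + 1 := by
          unfold totalRounds
          have := Nat.mul_le_mul (show 3 * searchLength m Δ k + 2 ≤ 25 * n ^ 2 by omega) hlog
          omega
      _ ≤ 32 * n ^ 3 := by nlinarith [Nat.pow_pos (n := 3) (show 0 < n by omega)]
      _ ≤ n ^ 5 * n ^ 3 := Nat.mul_le_mul_right _ hn5
      _ = n ^ 8 := by ring
  have hn2' : n + 1 ≤ n ^ 2 := by nlinarith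
  calc memoCard m Δ k
      ≤ n * (n ^ 2 * (n ^ 2 * (n * n))) * n ^ 8 := by
        unfold memoCard
        gcongr <;> omega
    _ = n ^ 15 := by ring

theorem clog_le_two_mul_logb {n : ℕ} (hn : 1 ≤ n) :
    (Nat.clog 2 n : ℝ) ≤ 2 * Real.logb 2 n := by
  rcases hn.eq_or_lt with rfl | hn
  · simp
  · have h1 : (1 : ℝ) ≤ Real.logb 2 n := by
      rw [Real.le_logb_iff_rpow_le one_lt_two (by positivity)]
      simpa using (show (2 : ℝ) ≤ n by exact_mod_cast hn)
    have h2 : Nat.clog 2 n ≤ Nat.log 2 n + 1 :=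
      Nat.clog_le_of_le_pow (Nat.lt_pow_succ_log_self one_lt_two n).le
    have h3 : ((Nat.clog 2 n : ℕ) : ℝ) ≤ (Nat.log 2 n : ℕ) + 1 := by exact_mod_cast h2
    have h4 := Real.natLog_le_logb n 2
    push_cast at h4
    linarith

theorem bits_dispersionAlgorithm_le {n m Δ : ℕ} (hn : 1 ≤ n) (hk : k ≤ n) (hΔ : Δ + 1 ≤ n) :
    (((dispersionAlgorithm n m Δ k).bits Δ : ℕ) : ℝ) ≤ 52 * Real.logb 2 n := by
  have h1 := clog_le_two_mul_logb hn
  have h0 : (0 : ℝ) ≤ Real.logb 2 n := Real.logb_nonneg one_lt_two (by exact_mod_cast hn)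
  have h2 : (dispersionAlgorithm n m Δ k).bits Δ ≤ 18 * Nat.clog 2 n := by
    have ha : Nat.clog 2 k ≤ Nat.clog 2 n := Nat.clog_mono_right 2 hk
    have hb : Nat.clog 2 (Δ + 1) ≤ Nat.clog 2 n := Nat.clog_mono_right 2 hΔ
    have hc : (dispersionAlgorithm n m Δ k).memBits ≤ 15 * Nat.clog 2 n := by
      unfold dispersionAlgorithm
      split_ifs with h
      · exact Nat.zero_le _
      · change Nat.clog 2 (memoCard m Δ k) ≤ _
        refine Nat.clog_le_of_le_pow ((memoCard_le (by omega) hk hΔ).trans ?_)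
        rw [mul_comm, pow_mul]
        exact Nat.pow_le_pow_left (Nat.le_pow_clog one_lt_two n) 15
    unfold RobotProgram.bits
    omega
  have h3 : (((dispersionAlgorithm n m Δ k).bits Δ : ℕ) : ℝ) ≤ 18 * (Nat.clog 2 n : ℕ) := by
    exact_mod_cast h2
  linarith

theorem totalRounds_le {m Δ : ℕ} (hk : 2 ≤ k) (h : 1 ≤ min m (k * Δ)) :
    (totalRounds m Δ k : ℝ) ≤ 52 * ((min m (k * Δ) : ℕ) : ℝ) * Real.logb 2 k := by
  have h1 : 3 * searchLength m Δ k + 2 ≤ 26 * min m (k * Δ) := by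
    unfold searchLength; omega
  have h2 : 1 ≤ Nat.log 2 k := Nat.log_pos one_lt_two hk
  have h3 : totalRounds m Δ k ≤ 52 * min m (k * Δ) * Nat.log 2 k :=
    calc totalRounds m Δ k ≤ (26 * min m (k * Δ)) * (2 * Nat.log 2 k) :=
          Nat.mul_le_mul h1 (by omega)
      _ = 52 * min m (k * Δ) * Nat.log 2 k := by ring
  have h4 := Real.natLog_le_logb k 2
  calc (totalRounds m Δ k : ℝ) ≤ ((52 * min m (k * Δ) * Nat.log 2 k : ℕ) : ℝ) := by
        exact_mod_cast h3
    _ = 52 * ((min m (k * Δ) : ℕ) : ℝ) * (Nat.log 2 k : ℕ) := by push_cast; ring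
    _ ≤ _ := by
        refine mul_le_mul_of_nonneg_left ?_ (by positivity)
        exact_mod_cast h4

/-- The algorithm disperses at least two robots within its total number of rounds. -/
theorem solvesDispersionWithin_totalRounds (hG : G.Connected) (hk : k ≤ Fintype.card V)
    (hk2 : 2 ≤ k) (L : PortLabelling G) (start : Fin k → V) (n : ℕ) :
    (dispersionAlgorithm n G.edgeFinset.card G.maxDegree k).SolvesDispersionWithin L start
      (totalRounds G.edgeFinset.card G.maxDegree k) := by
  obtain ⟨h1, h2⟩ := min_bounds hG hk hk2
  rw [dispersionAlgorithm, if_neg (by omega)]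
  have hrun := ClockedRule.pos_run_of_implements (ClockedRule.implements_toProgram
    (dispersionRule k G.maxDegree (searchLength G.edgeFinset.card G.maxDegree k))
    (exists_coding G.edgeFinset.card G.maxDegree k).some) L start
  constructor
  · rw [hrun, min_self]
    exact ClockedRule.pos_injective_run hG hk (fun v => G.degree_le_maxDegree v)
      (suffices_searchLength hG hk hk2) (by unfold searchLength; omega) _ start
      (Nat.lt_pow_succ_log_self one_lt_two k)
  · intro t ht
    rw [hrun, hrun, min_self, min_eq_right ht]

end Cost

theorem theorem1 :
    ∃ (A : DispersionAlgorithm) (C : ℝ),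
      ∀ (n m Δ k : ℕ) (V : Type*) [Fintype V] [DecidableEq V]
        (G : SimpleGraph V) [DecidableRel G.Adj] (L : PortLabelling G),
        G.Connected → Fintype.card V = n → G.edgeFinset.card = m → G.maxDegree = Δ → k ≤ n →
        (((A n m Δ k).bits Δ : ℕ) : ℝ) ≤ C * Real.logb 2 n ∧
        ∀ start : Fin k → V,
          ∃ T : ℕ, (T : ℝ) ≤ C * ((min m (k * Δ) : ℕ) : ℝ) * Real.logb 2 k ∧
            (A n m Δ k).SolvesDispersionWithin L start T := by
  refine ⟨dispersionAlgorithm, 52, ?_⟩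
  rintro _ _ _ k V _ _ G _ L hG rfl rfl rfl hk
  have := hG.nonempty
  refine ⟨bits_dispersionAlgorithm_le Fintype.card_pos hk ?_, fun start => ?_⟩
  · obtain ⟨v, hv⟩ := G.exists_maximal_degree_vertex
    rw [hv]
    exact G.degree_lt_card_verts v
  · rcases Nat.lt_or_ge 1 k with h | h
    · exact ⟨_, totalRounds_le h (min_bounds hG hk h).1,
        solvesDispersionWithin_totalRounds hG hk h L start _⟩
    · refine ⟨0, ?_, ?_⟩
      · have : Real.logb 2 (k : ℝ) = 0 := by
          interval_cases k <;> simp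
        simp [this]
      · rw [dispersionAlgorithm, if_pos h]
        constructor
        · intro a b _
          ext
          omega
        · intro t _
          rw [RobotProgram.pos_run_idle, RobotProgram.pos_run_idle]
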